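/- Let $H^1_{0,1}=\{\theta\in H^1[0,1] : \theta(0)=0\}$ (continuous representatives), equipped with the $H^1$ norm, and for $b>0$ let $$E_b(\theta)=\frac12\int_0^1|\theta'(s)|^2\,ds-b\int_0^1(1-s)\sin\theta(s)\,ds,\qquad \theta\in H^1_{0,1}.$$ There exists $b_0>0$ such that for every $b>b_0$ there is a function $\theta\in C^2[0,1]$ with $\theta(0)=0$ such that: 1. $\theta$ is a local minimizer of $E_b$ in $H^1_{0,1}$: there is $\varepsilon>0$ such that $E_b(\theta)\le E_b(u)$ for all $u\in H^1_{0,1}$ with $\|u-\theta\|_{H^1}<\varepsilon$; 2. $\theta''(s)=-b(1-s)\cos\theta(s)$ for all $s\in[0,1]$, and $\theta'(1)=0$; 3. $\theta(s)<0$ for all $s\in(0,1]$, and $\theta$ is strictly decreasing on $(0,1]$; 4. $E_b(\theta)\le E_b(u)$ for every $u\in H^1_{0,1}$ with $u<0$ on $(0,1]$, that is, $\theta$ minimizes $E_b$ over the cone of functions in $H^1_{0,1}$ that are negative on $(0,1]$. -/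

import Mathlib

open MeasureTheory Set
open scoped ContDiff

noncomputable section

namespace Elastica

/-- `g` is a weak derivative of `θ` on the open interval `(0,1)`: integration by parts holds against
every smooth test function with compact support in `(0,1)`. -/
def IsWeakDeriv (θ g : ℝ → ℝ) : Prop :=
  ∀ φ : ℝ → ℝ, ContDiff ℝ ∞ φ → HasCompactSupport φ → tsupport φ ⊆ Ioo 0 1 →
    ∫ s in Ioo (0 : ℝ) 1, θ s * deriv φ s = -∫ s in Ioo (0 : ℝ) 1, g s * φ s

/-- `g` is a square-integrable weak derivative of `θ` on `(0,1)`. -/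
def IsL2WeakDeriv (θ g : ℝ → ℝ) : Prop :=
  MemLp g 2 (volume.restrict (Ioo (0 : ℝ) 1)) ∧ IsWeakDeriv θ g

/-- The Sobolev space `H¹[0,1]`, each class being given by its continuous representative on `[0,1]`
(the values of `θ` outside `[0,1]` are irrelevant). -/
def H1 : Set (ℝ → ℝ) :=
  {θ | ContinuousOn θ (Icc 0 1) ∧ ∃ g, IsL2WeakDeriv θ g}

/-- The space of all `θ ∈ H¹[0,1]` with `θ(0) = 0`. -/
def H101 : Set (ℝ → ℝ) :=
  {θ | θ ∈ H1 ∧ θ 0 = 0}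

open Classical in
/-- The weak derivative of `θ ∈ H¹[0,1]`; it is unique up to equality almost everywhere on `(0,1)`. -/
def weakDeriv (θ : ℝ → ℝ) : ℝ → ℝ :=
  if h : ∃ g, IsL2WeakDeriv θ g then h.choose else 0

/-- The `H¹` norm on `(0,1)`. -/
def h1Norm (θ : ℝ → ℝ) : ℝ :=
  Real.sqrt ((∫ s in Ioo (0 : ℝ) 1, θ s ^ 2) + ∫ s in Ioo (0 : ℝ) 1, weakDeriv θ s ^ 2)

/-- The energy `E(θ) = ½ ∫ θ'² - b ∫ (1 - s) sin θ`. -/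
def energy (b : ℝ) (θ : ℝ → ℝ) : ℝ :=
  (1 / 2) * (∫ s in Ioo (0 : ℝ) 1, weakDeriv θ s ^ 2)
    - b * ∫ s in Ioo (0 : ℝ) 1, (1 - s) * Real.sin (θ s)

/-- `θ` is a local minimizer of the energy in `{θ ∈ H¹[0,1] | θ(0) = 0}`, for the `H¹` norm. -/
def IsLocalMinimizer (b : ℝ) (θ : ℝ → ℝ) : Prop :=
  θ ∈ H101 ∧ ∃ ε > 0, ∀ u ∈ H101, h1Norm (fun s => u s - θ s) < ε → energy b θ ≤ energy b u

/-- The cone of all `θ ∈ H¹[0,1]` with `θ(0) = 0` and `θ < 0` on `(0,1]`. -/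
def negCone : Set (ℝ → ℝ) :=
  {θ | θ ∈ H101 ∧ ∀ s ∈ Ioc (0 : ℝ) 1, θ s < 0}

/-- Classical solutions of `θ'' = -b (1 - s) cos θ` on `[0,1]` with `θ(0) = 0` and `θ'(1) = 0`
(derivatives at the endpoints are one-sided). -/
structure IsClassicalSolution (b : ℝ) (θ : ℝ → ℝ) : Prop where
  contDiffOn : ContDiffOn ℝ 2 θ (Icc 0 1)
  equation : ∀ s ∈ Icc (0 : ℝ) 1,
    derivWithin (derivWithin θ (Icc 0 1)) (Icc 0 1) s = -b * (1 - s) * Real.cos (θ s)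
  clamped : θ 0 = 0
  free : derivWithin θ (Icc 0 1) 1 = 0

end Elastica

end

noncomputable section

namespace Elastica

open Filter Topology

/-! The solution is obtained as a global minimiser of a modified functional. In `pot` the sine is
lowered on the right of `1/4`, which removes the well at `π/2` (there `pot` stays below `1/2`),
while the value `1` is still attained at `-3π/2`. Since `pot` equals `sin` on `(-∞, 1/4]`, a
minimiser `θ ≤ 0` of the modified functional beats every competitor `u ≤ 1/4` for the original
energy. This covers the negative cone and, by the embedding of H¹ in the continuous functions, an
H¹-ball around `θ`.

Functions in H¹ vanishing at `0` are identified with primitives of L² functions, so the direct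
method (`exists_minimizer`) runs in L²(0,1). Minimisers solve the Euler-Lagrange equation
(`IsMinimizer.exists_isExtremal`), and what remains is to prove that they decrease when `b` is
large.

A steep ramp down to `-3π/2` as competitor shows that the weighted deficit of `pot` from `1` is tiny
(`deficit_le`), so `θ` reaches `-π/2` at an early time `τ`. After `τ` it stays strictly between
`-3π/2` and `-π/2`: reflecting or flattening an excursion gives another minimiser agreeing with `θ`
near `0`, which ODE uniqueness forbids (`IsExtremal.eq_of_surgery`). Before `τ` it does not return
to `0`, since otherwise discarding the initial loop would lower the functional
(`IsExtremal.ne_zero`). The sign of the cosine then makes `θ` concave up to `τ` and convex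
afterwards, and `θ'(1) = 0` gives `θ' < 0` on `(0,1)`. -/

/-! ### Square-integrable functions and their primitives -/

/-- The primitive of `g` vanishing at `0`. -/
def primitive (g : ℝ → ℝ) (s : ℝ) : ℝ := ∫ t in (0 : ℝ)..s, g t

/-- The space of functions which are square integrable on `(0,1)`. -/
def L2 (g : ℝ → ℝ) : Prop := MemLp g 2 (volume.restrict (Ioo (0 : ℝ) 1))

lemma setIntegral_Ioo_eq (f : ℝ → ℝ) : ∫ s in Ioo (0 : ℝ) 1, f s = ∫ s in (0 : ℝ)..1, f s := by
  rw [intervalIntegral.integral_of_le zero_le_one, integral_Ioc_eq_integral_Ioo]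

lemma L2.integrableOn {g : ℝ → ℝ} (hg : L2 g) : IntegrableOn g (Ioo 0 1) :=
  MemLp.integrable (by norm_num) hg

lemma L2.intervalIntegrable {g : ℝ → ℝ} (hg : L2 g) : IntervalIntegrable g volume 0 1 := by
  rw [intervalIntegrable_iff_integrableOn_Ioo_of_le zero_le_one]
  exact hg.integrableOn

lemma L2.intervalIntegrable' {g : ℝ → ℝ} (hg : L2 g) {s t : ℝ} (hs : s ∈ Icc (0 : ℝ) 1)
    (ht : t ∈ Icc (0 : ℝ) 1) : IntervalIntegrable g volume s t :=
  hg.intervalIntegrable.mono_set (by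
    rw [uIcc_of_le (zero_le_one' ℝ)]
    exact uIcc_subset_Icc hs ht)

lemma L2.of_continuousOn {g : ℝ → ℝ} (hg : ContinuousOn g (Icc 0 1)) : L2 g := by
  obtain ⟨C, hC⟩ := isCompact_Icc.exists_bound_of_continuousOn hg
  refine MemLp.of_bound
    ((hg.mono Ioo_subset_Icc_self).aestronglyMeasurable measurableSet_Ioo) C ?_
  filter_upwards [ae_restrict_mem measurableSet_Ioo] with x hx using hC x (Ioo_subset_Icc_self hx)

lemma L2.integrable_sq {g : ℝ → ℝ} (hg : L2 g) : IntegrableOn (fun s => g s ^ 2) (Ioo 0 1) :=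
  MemLp.integrable_sq hg

lemma L2.integrable_mul {g h : ℝ → ℝ} (hg : L2 g) (hh : L2 h) :
    IntegrableOn (fun s => g s * h s) (Ioo 0 1) :=
  MemLp.integrable_mul hg hh

lemma primitive_zero (g : ℝ → ℝ) : primitive g 0 = 0 := by simp [primitive]

lemma absolutelyContinuous_primitive {g : ℝ → ℝ} (hg : L2 g) :
    AbsolutelyContinuousOnInterval (primitive g) 0 1 :=
  hg.intervalIntegrable.absolutelyContinuousOnInterval_intervalIntegral (by simp)

lemma continuousOn_primitive {g : ℝ → ℝ} (hg : L2 g) : ContinuousOn (primitive g) (Icc 0 1) := by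
  simpa using (absolutelyContinuous_primitive hg).continuousOn

lemma primitive_add {g h : ℝ → ℝ} (hg : L2 g) (hh : L2 h) {s : ℝ} (hs : s ∈ Icc (0 : ℝ) 1) :
    primitive (fun t => g t + h t) s = primitive g s + primitive h s :=
  intervalIntegral.integral_add (hg.intervalIntegrable' (by simp) hs)
    (hh.intervalIntegrable' (by simp) hs)

lemma primitive_sub {g h : ℝ → ℝ} (hg : L2 g) (hh : L2 h) {s : ℝ} (hs : s ∈ Icc (0 : ℝ) 1) :
    primitive (fun t => g t - h t) s = primitive g s - primitive h s :=
  intervalIntegral.integral_sub (hg.intervalIntegrable' (by simp) hs)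
    (hh.intervalIntegrable' (by simp) hs)

lemma primitive_const_mul (c : ℝ) (g : ℝ → ℝ) (s : ℝ) :
    primitive (fun t => c * g t) s = c * primitive g s :=
  intervalIntegral.integral_const_mul c g

lemma primitive_congr_ae {g h : ℝ → ℝ} (hgh : g =ᵐ[volume.restrict (Ioo (0 : ℝ) 1)] h) {s : ℝ}
    (hs : s ∈ Icc (0 : ℝ) 1) : primitive g s = primitive h s := by
  refine intervalIntegral.integral_congr_ae ?_
  have h1 : ∀ᵐ x : ℝ, x ≠ 1 := by simp [ae_iff, measure_singleton]
  filter_upwards [(ae_restrict_iff' measurableSet_Ioo).1 hgh, h1] with x hx hx1 hxs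
  rw [uIoc_of_le hs.1] at hxs
  exact hx ⟨hxs.1, lt_of_le_of_ne (hxs.2.trans hs.2) hx1⟩

/-! ### Weak derivatives, and H¹ functions as primitives -/

/-- Integration by parts for a primitive. -/
lemma integral_primitive_mul_deriv {g : ℝ → ℝ} (hg : L2 g) {φ : ℝ → ℝ} (hφ : ContDiff ℝ 1 φ) :
    ∫ s in (0 : ℝ)..1, primitive g s * deriv φ s
      = primitive g 1 * φ 1 - ∫ s in (0 : ℝ)..1, g s * φ s := by
  have hac : AbsolutelyContinuousOnInterval φ 0 1 :=
    ContDiffOn.absolutelyContinuousOnInterval hφ.contDiffOn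
  rw [(absolutelyContinuous_primitive hg).integral_mul_deriv_eq_deriv_mul hac, primitive_zero]
  have : ∫ x in (0 : ℝ)..1, deriv (primitive g) x * φ x = ∫ s in (0 : ℝ)..1, g s * φ s := by
    refine intervalIntegral.integral_congr_ae ?_
    filter_upwards [hg.intervalIntegrable.ae_hasDerivAt_integral] with x hx hxs
    have hd : HasDerivAt (primitive g) (g x) x := hx (uIoc_subset_uIcc hxs) 0 (by simp)
    rw [hd.deriv]
  rw [this]
  ring

lemma isWeakDeriv_of_eqOn_primitive {θ g : ℝ → ℝ} (hg : L2 g)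
    (hθ : EqOn θ (primitive g) (Icc 0 1)) : IsWeakDeriv θ g := by
  intro φ hφ _ hsupp
  have h1 : φ 1 = 0 := by
    by_contra h
    exact absurd (hsupp (subset_tsupport _ h)).2 (lt_irrefl _)
  have : ∫ s in Ioo (0 : ℝ) 1, θ s * deriv φ s
      = ∫ s in Ioo (0 : ℝ) 1, primitive g s * deriv φ s :=
    setIntegral_congr_fun measurableSet_Ioo fun s hs => by
      simp only [hθ (Ioo_subset_Icc_self hs)]
  rw [this, setIntegral_Ioo_eq, setIntegral_Ioo_eq,
    integral_primitive_mul_deriv hg (hφ.of_le (by exact_mod_cast le_top)), h1]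
  ring

lemma weakDeriv_ae_unique {θ g h : ℝ → ℝ} (hg : IsL2WeakDeriv θ g) (hh : IsL2WeakDeriv θ h) :
    g =ᵐ[volume.restrict (Ioo (0 : ℝ) 1)] h := by
  have hg1 : L2 g := hg.1
  have hh1 : L2 h := hh.1
  have key := isOpen_Ioo.ae_eq_zero_of_integral_contDiff_smul_eq_zero (μ := volume)
    (f := fun x => g x - h x) (U := Ioo (0 : ℝ) 1)
    (hg1.integrableOn.sub hh1.integrableOn).locallyIntegrableOn ?_
  · rw [Filter.EventuallyEq, ae_restrict_iff' measurableSet_Ioo]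
    filter_upwards [key] with x hx hxs
    linarith [hx hxs]
  · intro φ hφ hc hs
    have hφ2 : L2 φ := L2.of_continuousOn hφ.continuous.continuousOn
    have h1 : ∫ x, φ x • (g x - h x) = ∫ x in Ioo (0 : ℝ) 1, φ x • (g x - h x) := by
      rw [setIntegral_eq_integral_of_forall_compl_eq_zero]
      intro x hx
      have : φ x = 0 := by
        by_contra h
        exact hx (hs (subset_tsupport _ h))
      simp [this]
    rw [h1]
    have h2 : ∀ x, φ x • (g x - h x) = g x * φ x - h x * φ x := fun x => by
      simp only [smul_eq_mul]; ring
    simp_rw [h2]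
    rw [integral_sub (hg1.integrable_mul hφ2) (hh1.integrable_mul hφ2)]
    linarith [hg.2 φ hφ hc hs, hh.2 φ hφ hc hs]

/-- The fundamental lemma of du Bois-Reymond: a continuous function whose weak derivative vanishes
is constant. -/
lemma eqOn_const_of_isWeakDeriv_zero {w : ℝ → ℝ} (hw : ContinuousOn w (Icc 0 1))
    (h0 : IsWeakDeriv w 0) : ∃ c, ∀ s ∈ Icc (0 : ℝ) 1, w s = c := by
  have hw2 : L2 w := L2.of_continuousOn hw
  -- A fixed bump of unit mass serves to correct any test function to mean zero.
  let β : ContDiffBump (1 / 2 : ℝ) := ⟨1 / 8, 1 / 4, by norm_num, by norm_num⟩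
  let η : ℝ → ℝ := β.normed volume
  have hη : ContDiff ℝ ∞ η := β.contDiff_normed
  have hη1 : ∫ x, η x = 1 := β.integral_normed
  have hηs : tsupport η ⊆ Icc (1 / 4) (3 / 4) := by
    rw [show tsupport η = Metric.closedBall (1 / 2 : ℝ) β.rOut from β.tsupport_normed_eq]
    rw [Real.closedBall_eq_Icc]
    apply Icc_subset_Icc <;> norm_num [β]
  have hη2 : L2 η := L2.of_continuousOn hη.continuous.continuousOn
  set c : ℝ := ∫ x in Ioo (0 : ℝ) 1, w x * η x with hc
  have key := isOpen_Ioo.ae_eq_zero_of_integral_contDiff_smul_eq_zero (μ := volume)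
    (f := fun x => w x - c) (U := Ioo (0 : ℝ) 1)
    (hw2.integrableOn.sub (integrableOn_const (by simp) (by simp))).locallyIntegrableOn ?_
  · refine ⟨c, ?_⟩
    have hae : w =ᵐ[volume.restrict (Ioo (0 : ℝ) 1)] fun _ => c := by
      rw [Filter.EventuallyEq, ae_restrict_iff' measurableSet_Ioo]
      filter_upwards [key] with x hx hxs
      linarith [hx hxs]
    have hIoo : EqOn w (fun _ => c) (Ioo 0 1) :=
      Measure.eqOn_Ioo_of_ae_eq _ hae (hw.mono Ioo_subset_Icc_self) continuousOn_const
    have := hIoo.of_subset_closure hw continuousOn_const Ioo_subset_Icc_self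
      (by rw [closure_Ioo (by norm_num)])
    exact this
  · intro φ hφ hcs hs
    have hφ2 : L2 φ := L2.of_continuousOn hφ.continuous.continuousOn
    obtain ⟨a, d, ha, hd, had⟩ : ∃ a d : ℝ, 0 < a ∧ d < 1 ∧ tsupport φ ∪ tsupport η ⊆ Icc a d := by
      have hK : IsCompact (tsupport φ ∪ Icc (1 / 4 : ℝ) (3 / 4)) := hcs.isCompact.union isCompact_Icc
      have hne : (tsupport φ ∪ Icc (1 / 4 : ℝ) (3 / 4)).Nonempty := ⟨1 / 2, Or.inr (by norm_num)⟩
      have hsub : tsupport φ ∪ Icc (1 / 4 : ℝ) (3 / 4) ⊆ Ioo 0 1 :=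
        union_subset hs (fun x hx => ⟨by linarith [hx.1], by linarith [hx.2]⟩)
      refine ⟨_, _, (hsub (hK.sInf_mem hne)).1, (hsub (hK.sSup_mem hne)).2, ?_⟩
      exact (union_subset_union_right _ hηs).trans
        fun x hx => ⟨csInf_le hK.bddBelow hx, le_csSup hK.bddAbove hx⟩
    have hzφ : ∀ x, x ∉ Icc a d → φ x = 0 := fun x hx => by
      by_contra h
      exact hx (had (Or.inl (subset_tsupport _ h)))
    have hzη : ∀ x, x ∉ Icc a d → η x = 0 := fun x hx => by
      by_contra h
      exact hx (had (Or.inr (subset_tsupport _ h)))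
    have hIφ : ∫ x, φ x = ∫ x in Ioo (0 : ℝ) 1, φ x := by
      rw [setIntegral_eq_integral_of_forall_compl_eq_zero]
      exact fun x hx => hzφ x fun h => hx ⟨by linarith [h.1], by linarith [h.2]⟩
    set m : ℝ := ∫ x in Ioo (0 : ℝ) 1, φ x with hm
    -- Having mean zero and support in `[a, d]`, `f` has a primitive `ψ` that is itself an
    -- admissible test function. Testing the hypothesis with `ψ` gives `∫ w φ = m c`.
    let f : ℝ → ℝ := fun x => φ x - m * η x
    have hf : ContDiff ℝ ∞ f := hφ.sub (contDiff_const.mul hη)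
    have hzf : ∀ x, x ∉ Icc a d → f x = 0 := fun x hx => by simp [f, hzφ x hx, hzη x hx]
    let ψ : ℝ → ℝ := fun s => ∫ t in a..s, f t
    have hψd : ∀ s, HasDerivAt ψ (f s) s := fun s =>
      intervalIntegral.integral_hasDerivAt_right (hf.continuous.intervalIntegrable _ _)
        hf.continuous.stronglyMeasurable.stronglyMeasurableAtFilter hf.continuous.continuousAt
    have hψ' : deriv ψ = f := funext fun s => (hψd s).deriv
    have hψ : ContDiff ℝ ∞ ψ := by
      rw [contDiff_infty_iff_deriv, hψ']
      exact ⟨fun s => (hψd s).differentiableAt, hf⟩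
    have hInt : ∫ x, f x = 0 := by
      have h1 : Integrable φ := hφ.continuous.integrable_of_hasCompactSupport hcs
      have h2 : Integrable η := hη.continuous.integrable_of_hasCompactSupport β.hasCompactSupport_normed
      simp only [f]
      rw [integral_sub h1 (h2.const_mul m), integral_const_mul, hη1, hIφ]
      ring
    have had' : a ≤ d := by
      have : (1 / 2 : ℝ) ∈ Icc a d := by
        refine had (Or.inr (subset_tsupport _ ?_))
        have : (1 / 2 : ℝ) ∈ Function.support (β.normed volume) := by
          rw [β.support_normed_eq]
          exact Metric.mem_ball_self β.rOut_pos
        exact this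
      exact this.1.trans this.2
    have hψa : ∀ s, s ∉ Icc a d → ψ s = 0 := by
      intro s hs'
      rcases lt_or_ge s a with h | h
      · have : ψ s = ∫ t in a..s, (0 : ℝ) := by
          have h1 : ∀ᵐ x : ℝ, x ≠ a := by simp [ae_iff, measure_singleton]
          refine intervalIntegral.integral_congr_ae ?_
          filter_upwards [h1] with t hta ht
          rw [uIoc_of_ge h.le] at ht
          exact hzf t fun h' => hta (le_antisymm ht.2 h'.1)
        simpa using this
      · have hds : d < s := by
          by_contra hh
          exact hs' ⟨h, not_lt.1 hh⟩
        have : ψ s = ∫ x, f x := by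
          simp only [ψ]
          rw [intervalIntegral.integral_of_le h, ← integral_Icc_eq_integral_Ioc,
            setIntegral_eq_integral_of_forall_compl_eq_zero]
          exact fun x hx => hzf x fun h' => hx ⟨h'.1, h'.2.trans hds.le⟩
        rw [this, hInt]
    have hψts : tsupport ψ ⊆ Icc a d := by
      refine closure_minimal (fun x hx => ?_) isClosed_Icc
      by_contra h
      exact hx (hψa x h)
    have := h0 ψ hψ (isCompact_Icc.of_isClosed_subset (isClosed_tsupport _) hψts)
      (hψts.trans fun x hx => ⟨by linarith [hx.1], by linarith [hx.2]⟩)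
    rw [hψ'] at this
    simp only [Pi.zero_apply, zero_mul, integral_zero, neg_zero, f] at this
    have h1 : ∫ x, φ x • (w x - c) = ∫ x in Ioo (0 : ℝ) 1, φ x • (w x - c) := by
      rw [setIntegral_eq_integral_of_forall_compl_eq_zero]
      intro x hx
      rw [hzφ x fun h => hx ⟨by linarith [h.1], by linarith [h.2]⟩, zero_smul]
    rw [h1]
    have h2 : ∀ x, φ x • (w x - c) = w x * φ x - c * φ x := fun x => by
      simp only [smul_eq_mul]; ring
    have h3 : ∀ x, w x * (φ x - m * η x) = w x * φ x - m * (w x * η x) := fun x => by ring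
    simp_rw [h3] at this
    simp_rw [h2]
    rw [integral_sub (hw2.integrable_mul hφ2) ((hw2.integrable_mul hη2).const_mul m),
      integral_const_mul, ← hc] at this
    rw [integral_sub (hw2.integrable_mul hφ2) (hφ2.integrableOn.const_mul c),
      integral_const_mul, ← hm]
    linarith

/-- Functions in `H¹` vanishing at `0` are the primitives of their weak derivatives. -/
lemma eqOn_primitive_of_isL2WeakDeriv {θ g : ℝ → ℝ} (hθ : ContinuousOn θ (Icc 0 1))
    (h0 : θ 0 = 0) (hg : IsL2WeakDeriv θ g) : EqOn θ (primitive g) (Icc 0 1) := by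
  have hg2 : L2 g := hg.1
  have hP := continuousOn_primitive hg2
  obtain ⟨c, hc⟩ := eqOn_const_of_isWeakDeriv_zero (w := fun s => θ s - primitive g s)
    (hθ.sub hP) (by
      intro φ hφ hcs hs
      have hd : L2 (deriv φ) := L2.of_continuousOn
        (hφ.continuous_deriv (by exact_mod_cast le_top)).continuousOn
      have h1 := hg.2 φ hφ hcs hs
      have h2 := isWeakDeriv_of_eqOn_primitive hg2 (fun _ _ => rfl) φ hφ hcs hs
      simp_rw [sub_mul]
      rw [integral_sub ((L2.of_continuousOn hθ).integrable_mul hd)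
        ((L2.of_continuousOn hP).integrable_mul hd), h1, h2]
      simp)
  intro s hs
  have h1 := hc s hs
  have h2 := hc 0 (by simp)
  simp only [h0, primitive_zero] at h2
  linarith

lemma mem_H101_of_eqOn_primitive {θ g : ℝ → ℝ} (hg : L2 g)
    (hθ : EqOn θ (primitive g) (Icc 0 1)) : θ ∈ H101 :=
  ⟨⟨(continuousOn_primitive hg).congr hθ, g, hg, isWeakDeriv_of_eqOn_primitive hg hθ⟩, by
    rw [hθ (by simp), primitive_zero]⟩

lemma isL2WeakDeriv_weakDeriv {θ : ℝ → ℝ} (h : ∃ g, IsL2WeakDeriv θ g) :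
    IsL2WeakDeriv θ (weakDeriv θ) := by
  rw [weakDeriv, dif_pos h]
  exact h.choose_spec

lemma weakDeriv_ae_eq {θ g : ℝ → ℝ} (hg : L2 g) (hθ : EqOn θ (primitive g) (Icc 0 1)) :
    weakDeriv θ =ᵐ[volume.restrict (Ioo (0 : ℝ) 1)] g :=
  have h : IsL2WeakDeriv θ g := ⟨hg, isWeakDeriv_of_eqOn_primitive hg hθ⟩
  weakDeriv_ae_unique (isL2WeakDeriv_weakDeriv ⟨g, h⟩) h

lemma L2_weakDeriv {θ : ℝ → ℝ} (hθ : θ ∈ H101) : L2 (weakDeriv θ) :=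
  (isL2WeakDeriv_weakDeriv hθ.1.2).1

lemma eqOn_primitive_weakDeriv {θ : ℝ → ℝ} (hθ : θ ∈ H101) :
    EqOn θ (primitive (weakDeriv θ)) (Icc 0 1) :=
  eqOn_primitive_of_isL2WeakDeriv hθ.1.1 hθ.2 (isL2WeakDeriv_weakDeriv hθ.1.2)

/-- Cauchy-Schwarz in disguise: integrating `(g - c)² ≥ 0` over `(0, s)`, with `c` the value of the
primitive at `s`, gives `(2 - s) c² ≤ ∫ g²`, and `s ≤ 1`. -/
lemma sq_integral_le {g : ℝ → ℝ} (hg : L2 g) {s : ℝ} (hs : s ∈ Icc (0 : ℝ) 1) :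
    primitive g s ^ 2 ≤ ∫ t in Ioo (0 : ℝ) 1, g t ^ 2 := by
  set c := primitive g s
  have hsub : Ioo 0 s ⊆ Ioo (0 : ℝ) 1 := Ioo_subset_Ioo_right hs.2
  have hc : ∫ t in Ioo 0 s, g t = c := by
    simp only [c, primitive]
    rw [intervalIntegral.integral_of_le hs.1, integral_Ioc_eq_integral_Ioo]
  have hint := hg.integrable_sq.mono_set hsub
  have h1 : ∫ t in Ioo 0 s, (2 * c * g t - c ^ 2) ≤ ∫ t in Ioo 0 s, g t ^ 2 := by
    refine integral_mono (((hg.integrableOn.mono_set hsub).const_mul _).sub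
      (integrableOn_const (by simp) (by simp))) hint fun t => ?_
    simp only
    nlinarith [sq_nonneg (g t - c)]
  rw [integral_sub ((hg.integrableOn.mono_set hsub).const_mul _)
    (integrableOn_const (by simp) (by simp)), integral_const_mul, hc] at h1
  simp only [integral_const, measureReal_restrict_apply_univ, Real.volume_real_Ioo_of_le hs.1,
    smul_eq_mul, sub_zero] at h1
  have h2 : ∫ t in Ioo 0 s, g t ^ 2 ≤ ∫ t in Ioo (0 : ℝ) 1, g t ^ 2 :=
    setIntegral_mono_set hg.integrable_sq (ae_of_all _ fun t => sq_nonneg _)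
      (ae_of_all _ hsub)
  nlinarith [sq_nonneg c, hs.2]

/-- The Sobolev inequality on `{θ ∈ H¹ | θ(0) = 0}`. -/
lemma abs_le_h1Norm {θ : ℝ → ℝ} (hθ : θ ∈ H101) {s : ℝ} (hs : s ∈ Icc (0 : ℝ) 1) :
    |θ s| ≤ h1Norm θ := by
  rw [h1Norm, ← Real.sqrt_sq_eq_abs]
  apply Real.sqrt_le_sqrt
  have h1 := sq_integral_le (L2_weakDeriv hθ) hs
  rw [← eqOn_primitive_weakDeriv hθ hs] at h1
  have h2 : 0 ≤ ∫ s in Ioo (0 : ℝ) 1, θ s ^ 2 := integral_nonneg fun _ => sq_nonneg _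
  linarith

lemma sub_mem_H101 {u θ : ℝ → ℝ} (hu : u ∈ H101) (hθ : θ ∈ H101) :
    (fun s => u s - θ s) ∈ H101 := by
  have h1 := L2_weakDeriv hu
  have h2 := L2_weakDeriv hθ
  refine mem_H101_of_eqOn_primitive (g := fun t => weakDeriv u t - weakDeriv θ t)
    (MemLp.sub h1 h2) fun s hs => ?_
  rw [primitive_sub h1 h2 hs, ← eqOn_primitive_weakDeriv hu hs, ← eqOn_primitive_weakDeriv hθ hs]

/-! ### The functional on L² and the direct method -/

/-- The energy with potential `F`, as a functional of the derivative. -/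
def action (b : ℝ) (F : ℝ → ℝ) (g : ℝ → ℝ) : ℝ :=
  (1 / 2) * (∫ s in Ioo (0 : ℝ) 1, g s ^ 2)
    - b * ∫ s in Ioo (0 : ℝ) 1, (1 - s) * F (primitive g s)

lemma action_congr_ae {b : ℝ} {F g h : ℝ → ℝ}
    (hgh : g =ᵐ[volume.restrict (Ioo (0 : ℝ) 1)] h) : action b F g = action b F h := by
  have h1 : ∫ s in Ioo (0 : ℝ) 1, g s ^ 2 = ∫ s in Ioo (0 : ℝ) 1, h s ^ 2 :=
    integral_congr_ae (hgh.mono fun x hx => by simp only [hx])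
  have h2 : ∫ s in Ioo (0 : ℝ) 1, (1 - s) * F (primitive g s)
      = ∫ s in Ioo (0 : ℝ) 1, (1 - s) * F (primitive h s) :=
    setIntegral_congr_fun measurableSet_Ioo fun s hs => by
      simp only [primitive_congr_ae hgh (Ioo_subset_Icc_self hs)]
  rw [action, action, h1, h2]

lemma energy_eq_action {b : ℝ} {θ g F : ℝ → ℝ} (hg : L2 g) (hθ : EqOn θ (primitive g) (Icc 0 1))
    (hF : ∀ s ∈ Ioo (0 : ℝ) 1, F (θ s) = Real.sin (θ s)) : energy b θ = action b F g := by
  have h1 : ∫ s in Ioo (0 : ℝ) 1, weakDeriv θ s ^ 2 = ∫ s in Ioo (0 : ℝ) 1, g s ^ 2 :=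
    integral_congr_ae ((weakDeriv_ae_eq hg hθ).mono fun x hx => by simp only [hx])
  have h2 : ∫ s in Ioo (0 : ℝ) 1, (1 - s) * Real.sin (θ s)
      = ∫ s in Ioo (0 : ℝ) 1, (1 - s) * F (primitive g s) :=
    setIntegral_congr_fun measurableSet_Ioo fun s hs => by
      simp only [← hθ (Ioo_subset_Icc_self hs), hF s hs]
  rw [energy, action, h1, h2]

/-- Bounded sequences in a separable Hilbert space have weakly convergent subsequences. -/
lemma exists_weakly_convergent_subseq {H : Type*} [NormedAddCommGroup H] [InnerProductSpace ℝ H]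
    [CompleteSpace H] [TopologicalSpace.SeparableSpace H] (x : ℕ → H) (R : ℝ)
    (hx : ∀ n, ‖x n‖ ≤ R) : ∃ (y : H) (k : ℕ → ℕ), StrictMono k ∧
      ∀ h, Tendsto (fun n => inner ℝ (x (k n)) h) atTop (𝓝 (inner ℝ y h)) := by
  have hs := WeakDual.isSeqCompact_closedBall ℝ H 0 R
  obtain ⟨f, -, k, hk, hf⟩ := hs
    (x := fun n => StrongDual.toWeakDual (InnerProductSpace.toDual ℝ H (x n))) (fun n => by
      simpa using hx n)
  refine ⟨(InnerProductSpace.toDual ℝ H).symm (WeakDual.toStrongDual f), k, hk, fun h => ?_⟩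
  rw [InnerProductSpace.toDual_symm_apply]
  exact ((WeakDual.eval_continuous h).tendsto f).comp hf

lemma continuousOn_weight_comp {F g : ℝ → ℝ} (hF : Continuous F) (hg : L2 g) :
    ContinuousOn (fun s => (1 - s) * F (primitive g s)) (Icc 0 1) :=
  (continuousOn_const.sub continuousOn_id).mul (hF.comp_continuousOn (continuousOn_primitive hg))

lemma integrableOn_of_continuousOn {f : ℝ → ℝ} (hf : ContinuousOn f (Icc 0 1)) :
    IntegrableOn f (Ioo 0 1) :=
  hf.integrableOn_Icc.mono_set Ioo_subset_Icc_self

lemma integral_weight : ∫ s in Ioo (0 : ℝ) 1, (1 - s) = 1 / 2 := by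
  rw [setIntegral_Ioo_eq, intervalIntegral.integral_sub (by simp) (by simp)]
  norm_num

/-- The functional splits off the bulk term `-b / 2`. -/
lemma action_eq {b : ℝ} {F g : ℝ → ℝ} (hF : Continuous F) (hg : L2 g) :
    action b F g = (1 / 2) * (∫ s in Ioo (0 : ℝ) 1, g s ^ 2) - b / 2
      + b * ∫ s in Ioo (0 : ℝ) 1, (1 - s) * (1 - F (primitive g s)) := by
  have h1 := integrableOn_of_continuousOn (continuousOn_weight_comp hF hg)
  have h2 : ∫ s in Ioo (0 : ℝ) 1, (1 - s) * (1 - F (primitive g s))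
      = 1 / 2 - ∫ s in Ioo (0 : ℝ) 1, (1 - s) * F (primitive g s) := by
    simp_rw [mul_sub, mul_one]
    rw [integral_sub (integrableOn_of_continuousOn (by fun_prop)) h1, integral_weight]
  rw [action, h2]
  ring

lemma deficit_nonneg {F g : ℝ → ℝ} (hF1 : ∀ x, F x ≤ 1) :
    0 ≤ ∫ s in Ioo (0 : ℝ) 1, (1 - s) * (1 - F (primitive g s)) :=
  setIntegral_nonneg measurableSet_Ioo fun s hs =>
    mul_nonneg (by linarith [hs.2]) (by linarith [hF1 (primitive g s)])

lemma half_integral_sq_le {b : ℝ} (hb : 0 ≤ b) {F g : ℝ → ℝ} (hF : Continuous F)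
    (hF1 : ∀ x, F x ≤ 1) (hg : L2 g) :
    (1 / 2) * (∫ s in Ioo (0 : ℝ) 1, g s ^ 2) ≤ action b F g + b / 2 := by
  have := mul_nonneg hb (deficit_nonneg (g := g) hF1)
  rw [action_eq hF hg]
  linarith

lemma tendsto_integral_weight {F : ℝ → ℝ} (hF : Continuous F) {g : ℕ → ℝ → ℝ} {h : ℝ → ℝ}
    (hg : ∀ n, L2 (g n)) {R : ℝ} (hR : ∀ n, ∀ s ∈ Icc (0 : ℝ) 1, |primitive (g n) s| ≤ R)
    (hlim : ∀ s ∈ Icc (0 : ℝ) 1, Tendsto (fun n => primitive (g n) s) atTop (𝓝 (primitive h s))) :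
    Tendsto (fun n => ∫ s in Ioo (0 : ℝ) 1, (1 - s) * F (primitive (g n) s)) atTop
      (𝓝 (∫ s in Ioo (0 : ℝ) 1, (1 - s) * F (primitive h s))) := by
  obtain ⟨C, hC⟩ := (isCompact_Icc (a := -R) (b := R)).exists_bound_of_continuousOn hF.continuousOn
  refine tendsto_integral_of_dominated_convergence (fun _ => C)
    (fun n => (integrableOn_of_continuousOn (continuousOn_weight_comp hF (hg n))).1)
    (integrableOn_const (by simp) (by simp)) (fun n => ?_) ?_
  · filter_upwards [ae_restrict_mem measurableSet_Ioo] with s hs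
    rw [norm_mul, Real.norm_eq_abs (1 - s), abs_of_pos (by linarith [hs.2])]
    have h1 := hC _ (abs_le.1 (hR n s (Ioo_subset_Icc_self hs)))
    nlinarith [norm_nonneg (F (primitive (g n) s)), hs.1]
  · filter_upwards [ae_restrict_mem measurableSet_Ioo] with s hs
    exact ((hF.tendsto _).comp (hlim s (Ioo_subset_Icc_self hs))).const_mul _

/-- The direct method: the functional attains its minimum. -/
theorem exists_minimizer {b : ℝ} (hb : 0 ≤ b) {F : ℝ → ℝ} (hF : Continuous F)
    (hF1 : ∀ x, F x ≤ 1) : ∃ g, L2 g ∧ ∀ h, L2 h → action b F g ≤ action b F h := by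
  set S : Set ℝ := action b F '' {g | L2 g} with hS
  have h0 : L2 (fun _ => 0) := L2.of_continuousOn continuousOn_const
  have hSne : S.Nonempty := ⟨_, _, h0, rfl⟩
  have hSb : BddBelow S := by
    refine ⟨-(b / 2), ?_⟩
    rintro _ ⟨g, hg, rfl⟩
    have h1 := half_integral_sq_le hb hF hF1 hg
    have h2 : 0 ≤ ∫ s in Ioo (0 : ℝ) 1, g s ^ 2 := integral_nonneg fun _ => sq_nonneg _
    linarith
  obtain ⟨u, -, hu, huS⟩ := exists_seq_tendsto_sInf hSne hSb
  choose g hg hgu using huS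
  obtain ⟨A, hA⟩ := hu.bddAbove_range
  have hint : ∀ n, ∫ s in Ioo (0 : ℝ) 1, g n s ^ 2 ≤ 2 * (A + b / 2) := fun n => by
    have h1 := half_integral_sq_le hb hF hF1 (hg n)
    have h2 := hA ⟨n, rfl⟩
    rw [hgu n] at h1
    linarith
  set μ := volume.restrict (Ioo (0 : ℝ) 1)
  let G : ℕ → Lp ℝ 2 μ := fun n => (hg n).toLp (g n)
  have hG : ∀ n, G n =ᵐ[μ] g n := fun n => (hg n).coeFn_toLp
  have hnorm : ∀ f : Lp ℝ 2 μ, ‖f‖ ^ 2 = ∫ s, f s ^ 2 ∂μ := fun f => by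
    rw [← real_inner_self_eq_norm_sq, MeasureTheory.L2.inner_def]
    simp [sq]
  have hnormG : ∀ n, ‖G n‖ ^ 2 = ∫ s, g n s ^ 2 ∂μ := fun n => by
    rw [hnorm]
    exact integral_congr_ae ((hG n).mono fun x hx => by simp only [hx])
  have hbound : ∀ n, ‖G n‖ ≤ √(2 * (A + b / 2)) := fun n =>
    Real.le_sqrt_of_sq_le ((hnormG n).trans_le (hint n))
  have : Fact ((2 : ENNReal) ≠ ⊤) := ⟨by simp⟩
  obtain ⟨y, k, hk, hy⟩ := exists_weakly_convergent_subseq G _ hbound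
  have hy2 : L2 y := Lp.memLp y
  -- Evaluating a primitive at `s` is pairing with an indicator, so weak convergence of derivatives
  -- yields pointwise convergence of primitives.
  have hprim : ∀ (f : Lp ℝ 2 μ) {s : ℝ} (_ : s ∈ Icc (0 : ℝ) 1),
      inner ℝ f (indicatorConstLp 2 (measurableSet_Ioo (a := 0) (b := s)) (measure_ne_top μ _)
        (1 : ℝ)) = primitive f s := fun f s hs => by
    rw [real_inner_comm, MeasureTheory.L2.inner_indicatorConstLp_one, Measure.restrict_restrict measurableSet_Ioo,
      inter_eq_left.2 (Ioo_subset_Ioo_right hs.2), primitive,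
      intervalIntegral.integral_of_le hs.1, integral_Ioc_eq_integral_Ioo]
  have hΦ := tendsto_integral_weight hF (g := fun n => g (k n)) (h := y) (fun n => hg _)
    (R := √(2 * (A + b / 2)))
    (fun n s hs => Real.abs_le_sqrt ((sq_integral_le (hg _) hs).trans (hint _)))
    (fun s hs => by
      rw [← hprim y hs]
      refine (hy _).congr fun n => ?_
      rw [hprim _ hs]
      exact primitive_congr_ae (hG _) hs)
  -- Weak lower semicontinuity by the tangent inequality `½‖G‖² ≥ ⟨G, y⟩ - ½‖y‖²`, whose right side
  -- is weakly continuous in `G`.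
  have hlim := (((hy y).sub_const ((1 / 2) * ‖y‖ ^ 2)).sub (hΦ.const_mul b))
  have hle : action b F y ≤ sInf S := by
    have h1 : action b F y = inner ℝ y y - (1 / 2) * ‖y‖ ^ 2
        - b * ∫ s in Ioo (0 : ℝ) 1, (1 - s) * F (primitive y s) := by
      rw [action, ← hnorm, real_inner_self_eq_norm_sq]
      ring
    rw [h1]
    refine le_of_tendsto_of_tendsto' hlim (hu.comp hk.tendsto_atTop) fun n => ?_
    rw [Function.comp_apply, ← hgu, action, ← hnormG]
    have h2 : 0 ≤ ‖G (k n) - y‖ ^ 2 := sq_nonneg _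
    rw [norm_sub_sq_real] at h2
    linarith
  exact ⟨y, hy2, fun h hh => hle.trans (csInf_le hSb ⟨h, hh, rfl⟩)⟩

/-! ### The penalised potential -/

/-- The potential `sin`, penalised to the right of `1/4`. -/
def pot (x : ℝ) : ℝ := Real.sin x - max (x - 1 / 4) 0 ^ 2

/-- The derivative of `pot`. -/
def dpot (x : ℝ) : ℝ := Real.cos x - 2 * max (x - 1 / 4) 0

lemma continuous_pot : Continuous pot := by unfold pot; fun_prop

lemma continuous_dpot : Continuous dpot := by unfold dpot; fun_prop

lemma pot_of_le {x : ℝ} (hx : x ≤ 1 / 4) : pot x = Real.sin x := by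
  rw [pot, max_eq_right (by linarith)]
  ring

lemma dpot_of_le {x : ℝ} (hx : x ≤ 1 / 4) : dpot x = Real.cos x := by
  rw [dpot, max_eq_right (by linarith)]
  ring

lemma pot_le_sin (x : ℝ) : pot x ≤ Real.sin x := by
  have := sq_nonneg (max (x - 1 / 4) 0)
  unfold pot
  linarith

lemma pot_le_one (x : ℝ) : pot x ≤ 1 := (pot_le_sin x).trans (Real.sin_le_one x)

/-- This is what the penalty is designed for: beyond `1/4`, `sin x ≤ x` and `x - (x - 1/4)² = 1/2 -
(x - 3/4)²`. Staying above `-π/2` is therefore costly. -/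
lemma pot_le_half {x : ℝ} (hx : -(Real.pi / 2) ≤ x) : pot x ≤ 1 / 2 := by
  rcases le_total x 0 with h | h
  · have := Real.sin_nonpos_of_nonpos_of_neg_pi_le h (by linarith [Real.pi_pos])
    linarith [pot_le_sin x]
  · have h1 := Real.sin_le h
    rcases le_total x (1 / 4) with h2 | h2
    · linarith [pot_le_sin x]
    · rw [pot, max_eq_left (by linarith)]
      nlinarith [sq_nonneg (x - 3 / 4)]

/-- One unit of the constant `2` comes from the sine (mean value theorem and the Lipschitz bound for
the cosine), the other from the squared positive part. This one-sided Taylor estimate makes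
differentiation under the integral sign unnecessary. -/
lemma pot_quadratic_bound (x y : ℝ) : pot x + dpot x * (y - x) - 2 * (y - x) ^ 2 ≤ pot y := by
  have h1 : Real.sin x + Real.cos x * (y - x) - (y - x) ^ 2 ≤ Real.sin y := by
    have aux : ∀ ξ, |ξ - x| ≤ |y - x| →
        |(Real.cos ξ - Real.cos x) * (y - x)| ≤ (y - x) ^ 2 := fun ξ hξ => by
      rw [abs_mul, ← sq_abs (y - x), sq]
      exact mul_le_mul_of_nonneg_right ((Real.abs_cos_sub_cos_le ξ x).trans hξ) (abs_nonneg _)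
    obtain ⟨ξ, hξ, h⟩ : ∃ ξ, |ξ - x| ≤ |y - x| ∧ Real.sin y - Real.sin x = Real.cos ξ * (y - x) := by
      rcases lt_trichotomy x y with hxy | rfl | hxy
      · obtain ⟨ξ, hξ, h⟩ := exists_hasDerivAt_eq_slope Real.sin Real.cos hxy
          Real.continuous_sin.continuousOn fun t _ => Real.hasDerivAt_sin t
        refine ⟨ξ, abs_le_abs (by linarith [hξ.2]) (by linarith [hξ.1]), ?_⟩
        rw [h, div_mul_cancel₀ _ (by linarith)]
      · exact ⟨x, le_rfl, by ring⟩
      · obtain ⟨ξ, hξ, h⟩ := exists_hasDerivAt_eq_slope Real.sin Real.cos hxy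
          Real.continuous_sin.continuousOn fun t _ => Real.hasDerivAt_sin t
        refine ⟨ξ, ?_, ?_⟩
        · rw [abs_sub_comm ξ, abs_sub_comm y]
          exact abs_le_abs (by linarith [hξ.1]) (by linarith [hξ.2])
        · rw [h, ← neg_sub x y, mul_neg, div_mul_cancel₀ _ (by linarith)]
          ring
    have := neg_le_of_abs_le (aux ξ hξ)
    linarith
  have h2 : max (y - 1 / 4) 0 ^ 2 ≤ (max (x - 1 / 4) 0 + (y - x)) ^ 2 := by
    rcases le_total (y - 1 / 4) 0 with h | h
    · rw [max_eq_right h]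
      nlinarith [sq_nonneg (max (x - 1 / 4) 0 + (y - x))]
    · rw [max_eq_left h]
      have := le_max_left (x - 1 / 4) 0
      exact pow_le_pow_left₀ h (by linarith) 2
  unfold pot dpot
  nlinarith

lemma abs_dpot_sub_le (x y : ℝ) : |dpot x - dpot y| ≤ 3 * |x - y| := by
  have h1 := Real.abs_cos_sub_cos_le x y
  have h2 : |max (x - 1 / 4) 0 - max (y - 1 / 4) 0| ≤ |x - y| := by
    refine (abs_max_sub_max_le_abs _ _ _).trans ?_
    simp
  have : dpot x - dpot y
      = (Real.cos x - Real.cos y) - 2 * (max (x - 1 / 4) 0 - max (y - 1 / 4) 0) := by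
    unfold dpot; ring
  rw [this]
  refine (abs_sub _ _).trans ?_
  rw [abs_mul, abs_two]
  linarith

/-! ### The Euler-Lagrange equation and regularity of minimisers -/

/-- `g` minimises the penalised functional over `L²(0,1)`. -/
def IsMinimizer (b : ℝ) (g : ℝ → ℝ) : Prop :=
  L2 g ∧ ∀ h, L2 h → action b pot g ≤ action b pot h

/-- `θ` is twice continuously differentiable with derivative `p`, and solves the Euler-Lagrange
equation of the penalised functional on `[0,1]`, with its boundary conditions. -/
structure IsExtremal (b : ℝ) (θ p : ℝ → ℝ) : Prop where
  contDiff : ContDiff ℝ 2 θ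
  hasDerivAt : ∀ s, HasDerivAt θ (p s) s
  hasDerivAt_deriv : ∀ s ∈ Icc (0 : ℝ) 1, HasDerivAt p (-b * (1 - s) * dpot (θ s)) s
  clamped : θ 0 = 0
  free : p 1 = 0

lemma IsExtremal.continuous {b : ℝ} {θ p : ℝ → ℝ} (h : IsExtremal b θ p) : Continuous θ :=
  h.contDiff.continuous

lemma IsExtremal.continuous_deriv {b : ℝ} {θ p : ℝ → ℝ} (h : IsExtremal b θ p) : Continuous p := by
  have : deriv θ = p := funext fun s => (h.hasDerivAt s).deriv
  rw [← this]
  exact h.contDiff.continuous_deriv (by norm_num)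

lemma IsExtremal.primitive_eq {b : ℝ} {θ p : ℝ → ℝ} (h : IsExtremal b θ p) : primitive p = θ := by
  funext s
  rw [primitive, intervalIntegral.integral_eq_sub_of_hasDerivAt (fun x _ => h.hasDerivAt x)
    (h.continuous_deriv.intervalIntegrable _ _), h.clamped, sub_zero]

lemma IsExtremal.memL2 {b : ℝ} {θ p : ℝ → ℝ} (h : IsExtremal b θ p) : L2 p :=
  L2.of_continuousOn h.continuous_deriv.continuousOn

/-- Second-order expansion of the functional. -/
lemma action_add_le {b : ℝ} (hb : 0 ≤ b) {g h : ℝ → ℝ} (hg : L2 g) (hh : L2 h) (t : ℝ) :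
    action b pot (fun s => g s + t * h s) ≤ action b pot g
      + t * ((∫ s in Ioo (0 : ℝ) 1, g s * h s)
        - b * ∫ s in Ioo (0 : ℝ) 1, (1 - s) * dpot (primitive g s) * primitive h s)
      + t ^ 2 * ((1 / 2) * (∫ s in Ioo (0 : ℝ) 1, h s ^ 2)
        + 2 * b * ∫ s in Ioo (0 : ℝ) 1, (1 - s) * primitive h s ^ 2) := by
  have hth : L2 (fun s => t * h s) := MemLp.const_mul hh t
  have hgth : L2 (fun s => g s + t * h s) := MemLp.add hg hth
  have ch := continuousOn_primitive hh
  have cw : ContinuousOn (fun s : ℝ => 1 - s) (Icc 0 1) := by fun_prop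
  have i1 := integrableOn_of_continuousOn (continuousOn_weight_comp continuous_pot hg)
  have i2 : IntegrableOn (fun s => (1 - s) * dpot (primitive g s) * primitive h s) (Ioo 0 1) :=
    integrableOn_of_continuousOn ((continuousOn_weight_comp continuous_dpot hg).mul ch)
  have i3 : IntegrableOn (fun s => (1 - s) * primitive h s ^ 2) (Ioo 0 1) :=
    integrableOn_of_continuousOn (cw.mul (ch.pow 2))
  have e1 : ∫ s in Ioo (0 : ℝ) 1, (g s + t * h s) ^ 2 = (∫ s in Ioo (0 : ℝ) 1, g s ^ 2)
      + 2 * t * (∫ s in Ioo (0 : ℝ) 1, g s * h s) + t ^ 2 * ∫ s in Ioo (0 : ℝ) 1, h s ^ 2 := by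
    have i4 : IntegrableOn (fun s => g s ^ 2 + 2 * t * (g s * h s)) (Ioo 0 1) :=
      hg.integrable_sq.add ((hg.integrable_mul hh).const_mul _)
    rw [← integral_const_mul, ← integral_const_mul, ← integral_add hg.integrable_sq
      ((hg.integrable_mul hh).const_mul _), ← integral_add i4 (hh.integrable_sq.const_mul _)]
    refine integral_congr_ae (ae_of_all _ fun s => ?_)
    simp only
    ring
  have e2 : (∫ s in Ioo (0 : ℝ) 1, (1 - s) * pot (primitive g s))
      + t * (∫ s in Ioo (0 : ℝ) 1, (1 - s) * dpot (primitive g s) * primitive h s)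
      - 2 * t ^ 2 * (∫ s in Ioo (0 : ℝ) 1, (1 - s) * primitive h s ^ 2)
      ≤ ∫ s in Ioo (0 : ℝ) 1, (1 - s) * pot (primitive (fun s => g s + t * h s) s) := by
    have i4 : IntegrableOn (fun s => (1 - s) * pot (primitive g s)
        + t * ((1 - s) * dpot (primitive g s) * primitive h s)) (Ioo 0 1) :=
      i1.add (i2.const_mul _)
    rw [← integral_const_mul, ← integral_const_mul, ← integral_add i1 (i2.const_mul _),
      ← integral_sub i4 (i3.const_mul _)]
    refine setIntegral_mono_on (i4.sub (i3.const_mul _))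
      (integrableOn_of_continuousOn (continuousOn_weight_comp continuous_pot hgth))
      measurableSet_Ioo fun s hs => ?_
    rw [primitive_add hg hth (Ioo_subset_Icc_self hs), primitive_const_mul]
    have := mul_le_mul_of_nonneg_left
      (pot_quadratic_bound (primitive g s) (primitive g s + t * primitive h s))
      (show 0 ≤ 1 - s by linarith [hs.2])
    refine le_trans (le_of_eq ?_) this
    ring
  rw [action, action, e1]
  have := mul_le_mul_of_nonneg_left e2 hb
  linarith

lemma eq_zero_of_forall_quadratic_nonneg {A B : ℝ} (hB : 0 ≤ B)
    (h : ∀ t : ℝ, 0 ≤ t * A + t ^ 2 * B) : A = 0 := by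
  -- At this `t` the quadratic equals `-(A / (B + 1))²`; the `+ 1` covers the case `B = 0`.
  have h1 := h (-A / (B + 1))
  have h2 : -A / (B + 1) * A + (-A / (B + 1)) ^ 2 * B = -(A / (B + 1)) ^ 2 := by
    field_simp
    ring
  rw [h2] at h1
  have h3 : A / (B + 1) = 0 := by
    have := sq_nonneg (A / (B + 1))
    exact pow_eq_zero_iff (two_ne_zero) |>.1 (by linarith)
  rcases div_eq_zero_iff.1 h3 with h | h
  · exact h
  · linarith

/-- Minimisers are regular and solve the Euler-Lagrange equation. -/
theorem IsMinimizer.exists_isExtremal {b : ℝ} (hb : 0 ≤ b) {g : ℝ → ℝ} (hg : IsMinimizer b g) :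
    ∃ θ p, IsExtremal b θ p ∧ g =ᵐ[volume.restrict (Ioo (0 : ℝ) 1)] p ∧
      EqOn θ (primitive g) (Icc 0 1) := by
  obtain ⟨hg2, hmin⟩ := hg
  -- The constant extension beyond `[0,1]` is continuous on the whole line, so that the functions
  -- built from it have two-sided derivatives at the endpoints too.
  let ϑ : ℝ → ℝ := fun s => primitive g (projIcc 0 1 zero_le_one s)
  have hϑ : Continuous ϑ := (continuousOn_iff_continuous_domRestrict.1
    (continuousOn_primitive hg2)).comp continuous_projIcc
  have hϑeq : ∀ s ∈ Icc (0 : ℝ) 1, ϑ s = primitive g s := fun s hs => by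
    simp only [ϑ, projIcc_of_mem zero_le_one hs]
  let q : ℝ → ℝ := fun s => -b * (1 - s) * dpot (ϑ s)
  have hq : Continuous q := (by fun_prop : Continuous fun s : ℝ => -b * (1 - s)).mul
    (continuous_dpot.comp hϑ)
  -- The derivative that the equation predicts, integrated from the free end, where it vanishes.
  let p : ℝ → ℝ := fun t => ∫ x in (1 : ℝ)..t, q x
  have hp : ∀ s, HasDerivAt p (q s) s := fun s =>
    intervalIntegral.integral_hasDerivAt_right (hq.intervalIntegrable _ _)
      hq.stronglyMeasurable.stronglyMeasurableAtFilter hq.continuousAt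
  have hpc : Continuous p := continuous_iff_continuousAt.2 fun s => (hp s).continuousAt
  have hp' : deriv p = q := funext fun s => (hp s).deriv
  have hp1 : p 1 = 0 := intervalIntegral.integral_same
  have hpd : ContDiff ℝ 1 p := by
    rw [contDiff_one_iff_deriv, hp']
    exact ⟨fun s => (hp s).differentiableAt, hq⟩
  have hp2 : L2 p := L2.of_continuousOn hpc.continuousOn
  have hθ : ∀ s, HasDerivAt (primitive p) (p s) s := fun s =>
    intervalIntegral.integral_hasDerivAt_right (hpc.intervalIntegrable _ _)
      hpc.stronglyMeasurable.stronglyMeasurableAtFilter hpc.continuousAt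
  have hae : g =ᵐ[volume.restrict (Ioo (0 : ℝ) 1)] p := by
    -- In the direction `g - p` the first variation is `∫ (g - p)²`, which must vanish at a
    -- minimiser.
    set h : ℝ → ℝ := fun s => g s - p s with hh
    have hh2 : L2 h := MemLp.sub hg2 hp2
    have e1 : b * ∫ s in Ioo (0 : ℝ) 1, (1 - s) * dpot (primitive g s) * primitive h s
        = ∫ s in Ioo (0 : ℝ) 1, h s * p s := by
      have h1 := integral_primitive_mul_deriv hh2 hpd
      rw [hp1, hp', ← setIntegral_Ioo_eq, ← setIntegral_Ioo_eq] at h1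
      have h2 : ∫ s in Ioo (0 : ℝ) 1, primitive h s * q s
          = -b * ∫ s in Ioo (0 : ℝ) 1, (1 - s) * dpot (primitive g s) * primitive h s := by
        rw [← integral_const_mul]
        refine setIntegral_congr_fun measurableSet_Ioo fun s hs => ?_
        simp only [q, hϑeq s (Ioo_subset_Icc_self hs)]
        ring
      linarith
    have e2 : (∫ s in Ioo (0 : ℝ) 1, g s * h s) - ∫ s in Ioo (0 : ℝ) 1, h s * p s
        = ∫ s in Ioo (0 : ℝ) 1, h s ^ 2 := by
      rw [← integral_sub (hg2.integrable_mul hh2) (hh2.integrable_mul hp2)]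
      refine integral_congr_ae (ae_of_all _ fun s => ?_)
      simp only [hh]
      ring
    have e3 : ∫ s in Ioo (0 : ℝ) 1, h s ^ 2 = 0 := by
      refine eq_zero_of_forall_quadratic_nonneg (B := (1 / 2) * (∫ s in Ioo (0 : ℝ) 1, h s ^ 2)
        + 2 * b * ∫ s in Ioo (0 : ℝ) 1, (1 - s) * primitive h s ^ 2) ?_ fun t => ?_
      · have h1 : 0 ≤ ∫ s in Ioo (0 : ℝ) 1, h s ^ 2 := integral_nonneg fun _ => sq_nonneg _
        have h2 : 0 ≤ ∫ s in Ioo (0 : ℝ) 1, (1 - s) * primitive h s ^ 2 :=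
          setIntegral_nonneg measurableSet_Ioo fun s hs =>
            mul_nonneg (by linarith [hs.2]) (sq_nonneg _)
        positivity
      · have h1 := action_add_le hb hg2 hh2 t
        have h2 := hmin (fun s => g s + t * h s) (MemLp.add hg2 (MemLp.const_mul hh2 t))
        rw [e1, e2] at h1
        linarith
    have e4 := (integral_eq_zero_iff_of_nonneg (fun s => sq_nonneg (h s)) hh2.integrable_sq).1 e3
    filter_upwards [e4] with s hs
    have : h s = 0 := pow_eq_zero_iff (two_ne_zero) |>.1 hs
    simp only [hh] at this
    linarith
  have heq : EqOn (primitive p) (primitive g) (Icc 0 1) :=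
    fun s hs => (primitive_congr_ae hae hs).symm
  refine ⟨primitive p, p, ⟨?_, hθ, fun s hs => ?_, primitive_zero _, hp1⟩, hae, heq⟩
  · rw [show (2 : WithTop ℕ∞) = 1 + 1 by norm_num, contDiff_succ_iff_deriv,
      show deriv (primitive p) = p from funext fun s => (hθ s).deriv]
    exact ⟨fun s => (hθ s).differentiableAt, by simp, hpd⟩
  · rw [heq hs, ← hϑeq s hs]
    exact hp s

lemma IsMinimizer.congr_ae {b : ℝ} {g h : ℝ → ℝ} (hg : IsMinimizer b g)
    (hgh : g =ᵐ[volume.restrict (Ioo (0 : ℝ) 1)] h) : IsMinimizer b h :=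
  ⟨MemLp.ae_eq hgh hg.1, fun f hf => by
    rw [← action_congr_ae hgh]
    exact hg.2 f hf⟩

/-! ### Uniqueness for the initial value problem -/

/-- Uniqueness for the initial value problem of the Euler-Lagrange equation. -/
lemma eqOn_of_solutions {b : ℝ} (hb : 0 ≤ b) {θ p ϑ r : ℝ → ℝ}
    (hθ : ∀ s ∈ Icc (0 : ℝ) 1, HasDerivAt θ (p s) s)
    (hp : ∀ s ∈ Icc (0 : ℝ) 1, HasDerivAt p (-b * (1 - s) * dpot (θ s)) s)
    (hϑ : ∀ s ∈ Icc (0 : ℝ) 1, HasDerivAt ϑ (r s) s)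
    (hr : ∀ s ∈ Icc (0 : ℝ) 1, HasDerivAt r (-b * (1 - s) * dpot (ϑ s)) s)
    {a : ℝ} (ha : a ∈ Icc (0 : ℝ) 1) (h0 : θ a = ϑ a) (h1 : p a = r a) :
    EqOn θ ϑ (Icc 0 1) := by
  let v : ℝ → ℝ × ℝ → ℝ × ℝ := fun t x => (x.2, -b * (1 - t) * dpot x.1)
  let K : NNReal := ⟨3 * b + 1, by positivity⟩
  have hv : ∀ t ∈ Icc (0 : ℝ) 1, LipschitzOnWith K (v t) univ := fun t ht => by
    refine (LipschitzWith.of_dist_le_mul fun x y => ?_).lipschitzOnWith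
    have hx1 : |x.1 - y.1| ≤ dist x y := by rw [← Real.dist_eq]; exact le_max_left _ _
    have hx2 : |x.2 - y.2| ≤ dist x y := by rw [← Real.dist_eq]; exact le_max_right _ _
    have hd : 0 ≤ dist x y := dist_nonneg
    change max (dist _ _) (dist _ _) ≤ (3 * b + 1) * dist x y
    simp only [v, Real.dist_eq]
    refine max_le ?_ ?_
    · nlinarith [mul_nonneg hb hd]
    · rw [← mul_sub, abs_mul, abs_mul, abs_neg, abs_of_nonneg hb,
        abs_of_nonneg (show 0 ≤ 1 - t by linarith [ht.2])]
      have h2 : b * (1 - t) ≤ b := by nlinarith [ht.1]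
      calc b * (1 - t) * |dpot x.1 - dpot y.1| ≤ b * (3 * dist x y) :=
            mul_le_mul h2 ((abs_dpot_sub_le _ _).trans (by linarith)) (abs_nonneg _) hb
        _ ≤ (3 * b + 1) * dist x y := by linarith
  have hf : ∀ s ∈ Icc (0 : ℝ) 1, HasDerivAt (fun t => (θ t, p t)) (v s (θ s, p s)) s :=
    fun s hs => (hθ s hs).prodMk (hp s hs)
  have hg : ∀ s ∈ Icc (0 : ℝ) 1, HasDerivAt (fun t => (ϑ t, r t)) (v s (ϑ s, r s)) s :=
    fun s hs => (hϑ s hs).prodMk (hr s hs)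
  have hR : Icc a 1 ⊆ Icc (0 : ℝ) 1 := Icc_subset_Icc_left ha.1
  have hL : Icc 0 a ⊆ Icc (0 : ℝ) 1 := Icc_subset_Icc_right ha.2
  have heq : (θ a, p a) = (ϑ a, r a) := by rw [h0, h1]
  have right := ODE_solution_unique_of_mem_Icc_right (v := v) (s := fun _ => univ) (K := K)
    (fun t ht => hv t (hR (Ico_subset_Icc_self ht)))
    (fun t ht => (hf t (hR ht)).continuousAt.continuousWithinAt)
    (fun t ht => (hf t (hR (Ico_subset_Icc_self ht))).hasDerivWithinAt) (fun _ _ => trivial)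
    (fun t ht => (hg t (hR ht)).continuousAt.continuousWithinAt)
    (fun t ht => (hg t (hR (Ico_subset_Icc_self ht))).hasDerivWithinAt) (fun _ _ => trivial) heq
  have left := ODE_solution_unique_of_mem_Icc_left (v := v) (s := fun _ => univ) (K := K)
    (fun t ht => hv t (hL (Ioc_subset_Icc_self ht)))
    (fun t ht => (hf t (hL ht)).continuousAt.continuousWithinAt)
    (fun t ht => (hf t (hL (Ioc_subset_Icc_self ht))).hasDerivWithinAt) (fun _ _ => trivial)
    (fun t ht => (hg t (hL ht)).continuousAt.continuousWithinAt)
    (fun t ht => (hg t (hL (Ioc_subset_Icc_self ht))).hasDerivWithinAt) (fun _ _ => trivial) heq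
  intro s hs
  rcases le_total s a with h | h
  · exact congrArg Prod.fst (left ⟨hs.1, h⟩)
  · exact congrArg Prod.fst (right ⟨h, hs.2⟩)

/-- An extremal has nonzero slope where it meets a nonzero equilibrium. -/
lemma IsExtremal.deriv_ne_zero {b : ℝ} (hb : 0 ≤ b) {θ p : ℝ → ℝ} (h : IsExtremal b θ p) {s : ℝ}
    (hs : s ∈ Icc (0 : ℝ) 1) (hd : dpot (θ s) = 0) (h0 : θ s ≠ 0) : p s ≠ 0 := by
  intro hp
  -- With zero slope the extremal would coincide with the constant solution, contradicting its value
  -- `0` at the clamped end.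
  have := eqOn_of_solutions hb (fun t _ => h.hasDerivAt t) h.hasDerivAt_deriv
    (ϑ := fun _ => θ s) (r := fun _ => 0) (fun t _ => hasDerivAt_const t _)
    (fun t _ => by rw [hd, mul_zero]; exact hasDerivAt_const t _) hs rfl hp
    (left_mem_Icc.2 zero_le_one)
  exact h0 (this.symm.trans h.clamped)

/-! ### Surgery on minimisers -/

lemma primitive_indicator {f Φ : ℝ → ℝ} (hΦ : ∀ s, HasDerivAt Φ (f s) s) (hf : Continuous f)
    {σ σ' s : ℝ} (hσ : 0 ≤ σ) (hσσ' : σ ≤ σ') (hs : 0 ≤ s) :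
    primitive ((Ioc σ σ').indicator f) s = Φ (max σ (min s σ')) - Φ σ := by
  rw [primitive, intervalIntegral.integral_of_le hs, setIntegral_indicator measurableSet_Ioc,
    Ioc_inter_Ioc, sup_eq_right.2 hσ]
  rcases le_total σ s with h | h
  · have h1 : σ ≤ min s σ' := le_min h hσσ'
    rw [max_eq_right h1, ← intervalIntegral.integral_of_le h1]
    exact intervalIntegral.integral_eq_sub_of_hasDerivAt (fun x _ => hΦ x)
      (hf.intervalIntegrable _ _)
  · have h1 : min s σ' ≤ σ := (min_le_left _ _).trans h
    rw [max_eq_left h1, Ioc_eq_empty (not_lt.2 h1)]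
    simp

lemma L2.indicator {f : ℝ → ℝ} (hf : L2 f) {S : Set ℝ} (hS : MeasurableSet S) :
    L2 (S.indicator f) :=
  MemLp.indicator hS hf

lemma action_le_of_le {b : ℝ} (hb : 0 ≤ b) {F g h : ℝ → ℝ} (hF : Continuous F) (hg : L2 g)
    (hh : L2 h) (h1 : ∀ s ∈ Ioo (0 : ℝ) 1, h s ^ 2 ≤ g s ^ 2)
    (h2 : ∀ s ∈ Ioo (0 : ℝ) 1, F (primitive g s) ≤ F (primitive h s)) :
    action b F h ≤ action b F g := by
  have e1 : ∫ s in Ioo (0 : ℝ) 1, h s ^ 2 ≤ ∫ s in Ioo (0 : ℝ) 1, g s ^ 2 :=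
    setIntegral_mono_on hh.integrable_sq hg.integrable_sq measurableSet_Ioo h1
  have e2 : ∫ s in Ioo (0 : ℝ) 1, (1 - s) * F (primitive g s)
      ≤ ∫ s in Ioo (0 : ℝ) 1, (1 - s) * F (primitive h s) :=
    setIntegral_mono_on (integrableOn_of_continuousOn (continuousOn_weight_comp hF hg))
      (integrableOn_of_continuousOn (continuousOn_weight_comp hF hh)) measurableSet_Ioo
      fun s hs => mul_le_mul_of_nonneg_left (h2 s hs) (by linarith [hs.2])
  have := mul_le_mul_of_nonneg_left e2 hb
  rw [action, action]
  linarith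

/-- If contracting or reflecting a piece of a minimiser about its initial value does not decrease
the potential, then that piece is constant. -/
lemma IsExtremal.eq_of_surgery {b : ℝ} (hb : 0 ≤ b) {θ p : ℝ → ℝ} (h : IsExtremal b θ p)
    (hmin : IsMinimizer b p) {σ σ' c : ℝ} (hσ : 0 < σ) (hσσ' : σ < σ') (hσ' : σ' ≤ 1)
    (hc : c ^ 2 ≤ 1) (hc1 : c ≠ 1) (hend : σ' = 1 ∨ θ σ' = θ σ)
    (hpot : ∀ s ∈ Ioo σ σ', pot (θ s) ≤ pot (θ σ + c * (θ s - θ σ))) :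
    ∀ s ∈ Ioo σ σ', θ s = θ σ := by
  -- The slope is multiplied by `c` on `(σ, σ']`. This scales the piece about `θ σ` and, by `hend`,
  -- leaves the rest of the curve in place.
  set g : ℝ → ℝ := fun s => p s + (c - 1) * (Ioc σ σ').indicator p s with hg
  have hi : L2 ((Ioc σ σ').indicator p) := h.memL2.indicator measurableSet_Ioc
  have hg2 : L2 g := MemLp.add h.memL2 (MemLp.const_mul hi (c - 1))
  have hprim : ∀ s ∈ Icc (0 : ℝ) 1,
      primitive g s = θ s + (c - 1) * (θ (max σ (min s σ')) - θ σ) := fun s hs => by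
    rw [hg, primitive_add h.memL2 (MemLp.const_mul hi (c - 1)) hs, primitive_const_mul,
      primitive_indicator h.hasDerivAt h.continuous_deriv hσ.le hσσ'.le hs.1, h.primitive_eq]
  have hle : ∀ s ∈ Icc (0 : ℝ) 1, s ≤ σ → primitive g s = θ s := fun s hs hsσ => by
    rw [hprim s hs, max_eq_left ((min_le_left _ _).trans hsσ)]
    ring
  have hmid : ∀ s ∈ Ioo σ σ', primitive g s = θ σ + c * (θ s - θ σ) := fun s hs => by
    rw [hprim s ⟨(hσ.trans hs.1).le, hs.2.le.trans hσ'⟩, min_eq_left hs.2.le, max_eq_right hs.1.le]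
    ring
  have hact : action b pot g ≤ action b pot p := by
    refine action_le_of_le hb continuous_pot h.memL2 hg2 (fun s hs => ?_) fun s hs => ?_
    · by_cases hsm : s ∈ Ioc σ σ'
      · simp only [hg, indicator_of_mem hsm]
        nlinarith [sq_nonneg (p s)]
      · simp [hg, indicator_of_notMem hsm]
    · rw [h.primitive_eq]
      rcases le_or_gt s σ with h1 | h1
      · rw [hle s (Ioo_subset_Icc_self hs) h1]
      · rcases lt_or_ge s σ' with h2 | h2
        · rw [hmid s ⟨h1, h2⟩]
          exact hpot s ⟨h1, h2⟩
        · rcases hend with h3 | h3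
          · linarith [hs.2]
          · rw [hprim s (Ioo_subset_Icc_self hs), min_eq_right h2, max_eq_right hσσ'.le, h3]
            simp
  -- The modified curve is also a minimiser, hence an extremal. It agrees with `θ` around `σ / 2`,
  -- so in value and slope there, hence on all of `[0,1]`; as `c ≠ 1`, the piece is constant.
  have hgmin : IsMinimizer b g := ⟨hg2, fun f hf => hact.trans (hmin.2 f hf)⟩
  obtain ⟨ϑ, r, hϑ, -, hϑg⟩ := hgmin.exists_isExtremal hb
  have hmem : σ / 2 ∈ Icc (0 : ℝ) 1 := ⟨by linarith, by linarith⟩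
  have hev : θ =ᶠ[𝓝 (σ / 2)] ϑ := by
    filter_upwards [Ioo_mem_nhds (show 0 < σ / 2 by linarith) (show σ / 2 < σ by linarith)]
      with s hs
    have hs1 : s ∈ Icc (0 : ℝ) 1 := ⟨hs.1.le, by linarith [hs.2]⟩
    rw [hϑg hs1, hle s hs1 hs.2.le]
  have heq := eqOn_of_solutions hb (fun t _ => h.hasDerivAt t) h.hasDerivAt_deriv
    (fun t _ => hϑ.hasDerivAt t) hϑ.hasDerivAt_deriv hmem hev.self_of_nhds
    ((h.hasDerivAt _).unique ((hϑ.hasDerivAt _).congr_of_eventuallyEq hev))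
  intro s hs
  have hs1 : s ∈ Icc (0 : ℝ) 1 := ⟨(hσ.trans hs.1).le, hs.2.le.trans hσ'⟩
  have h1 := heq hs1
  rw [hϑg hs1, hmid s hs] at h1
  have h2 : (1 - c) * (θ s - θ σ) = 0 := by linarith
  rcases mul_eq_zero.1 h2 with h3 | h3
  · exact absurd (by linarith) hc1
  · linarith

/-! ### Smallness of the deficit and the first crossing of `-π/2` -/

open Real

/-- The weighted distance of the potential from its maximal value along `θ`. -/
def deficit (θ : ℝ → ℝ) : ℝ := ∫ s in Ioo (0 : ℝ) 1, (1 - s) * (1 - pot (θ s))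

lemma pot_neg_three_pi_div_two : pot (-(3 * π / 2)) = 1 := by
  rw [pot_of_le (by linarith [pi_pos]), show -(3 * π / 2) = π / 2 - 2 * π by ring, sin_sub_two_pi,
    sin_pi_div_two]

lemma setIntegral_indicator_Ioc {a : ℝ} (ha : a < 1) (f : ℝ → ℝ) :
    ∫ s in Ioo (0 : ℝ) 1, (Ioc 0 a).indicator f s = ∫ s in Ioc 0 a, f s := by
  have hsub : Ioc 0 a ⊆ Ioo (0 : ℝ) 1 := fun s hs => ⟨hs.1, hs.2.trans_lt ha⟩
  rw [setIntegral_indicator measurableSet_Ioc, inter_eq_right.2 hsub]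

/-- For large `b` the deficit of a minimiser is small. -/
lemma deficit_le {b : ℝ} (hb : 10 ^ 8 ≤ b) {g : ℝ → ℝ} (hg : IsMinimizer b g) :
    deficit (primitive g) ≤ 1 / 1000 := by
  have hb0 : 0 < b := by linarith
  -- The competitor is a ramp reaching `-3π/2` at `1/4000`. Its Dirichlet integral is below `10⁵`
  -- and its deficit at most `2 / 4000`, so the minimiser has deficit at most `50000 / b + 1/2000`;
  -- this is where `10⁸` comes from.
  let m : ℝ := -(3 * π / 2) * 4000
  set h : ℝ → ℝ := (Ioc 0 (1 / 4000)).indicator fun _ => m with hh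
  have hh2 : L2 h := L2.indicator (L2.of_continuousOn continuousOn_const) measurableSet_Ioc
  have hprim : ∀ s ∈ Ioo (0 : ℝ) 1, primitive h s = m * min s (1 / 4000) := fun s hs => by
    rw [hh, primitive_indicator (Φ := fun x => m * x) (f := fun _ => m)
      (fun x => by simpa using (hasDerivAt_id x).const_mul m) continuous_const le_rfl
      (by norm_num) hs.1.le, max_eq_right (le_min hs.1.le (by norm_num))]
    ring
  have e1 : ∫ s in Ioo (0 : ℝ) 1, h s ^ 2 ≤ 100000 := by
    have h1 : ∀ s, h s ^ 2 = (Ioc (0 : ℝ) (1 / 4000)).indicator (fun _ => m ^ 2) s := fun s => by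
      by_cases hs : s ∈ Ioc (0 : ℝ) (1 / 4000)
      · rw [hh, indicator_of_mem hs, indicator_of_mem hs]
      · rw [hh, indicator_of_notMem hs, indicator_of_notMem hs, zero_pow two_ne_zero]
    simp_rw [h1]
    rw [setIntegral_indicator_Ioc (by norm_num), setIntegral_const, smul_eq_mul,
      Real.volume_real_Ioc_of_le (by norm_num)]
    have := pi_pos
    have := pi_lt_d2
    simp only [m]
    nlinarith
  have e2 : ∫ s in Ioo (0 : ℝ) 1, (1 - s) * (1 - pot (primitive h s)) ≤ 1 / 2000 := by
    have h1 : ∫ s in Ioo (0 : ℝ) 1, (Ioc (0 : ℝ) (1 / 4000)).indicator (fun _ => (2 : ℝ)) s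
        = 1 / 2000 := by
      rw [setIntegral_indicator_Ioc (by norm_num), setIntegral_const, smul_eq_mul,
        Real.volume_real_Ioc_of_le (by norm_num)]
      norm_num
    rw [← h1]
    refine setIntegral_mono_on (integrableOn_of_continuousOn (continuousOn_weight_comp
      (F := fun x => 1 - pot x) (continuous_const.sub continuous_pot) hh2))
      (L2.integrableOn (L2.indicator (L2.of_continuousOn continuousOn_const) measurableSet_Ioc))
      measurableSet_Ioo fun s hs => ?_
    rw [hprim s hs]
    rcases le_or_gt s (1 / 4000) with h2 | h2
    · rw [indicator_of_mem (show s ∈ Ioc (0 : ℝ) (1 / 4000) from ⟨hs.1, h2⟩), min_eq_left h2,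
        pot_of_le (by simp only [m]; nlinarith [pi_pos, hs.1, mul_pos pi_pos hs.1])]
      nlinarith [neg_one_le_sin (m * s), sin_le_one (m * s), hs.1, hs.2]
    · rw [indicator_of_notMem (fun h3 => absurd h3.2 (not_le.2 h2)), min_eq_right h2.le,
        show m * (1 / 4000) = -(3 * π / 2) by simp only [m]; ring, pot_neg_three_pi_div_two]
      simp
  have h1 := hg.2 h hh2
  rw [action_eq continuous_pot hg.1, action_eq continuous_pot hh2] at h1
  have h2 : 0 ≤ ∫ s in Ioo (0 : ℝ) 1, g s ^ 2 := integral_nonneg fun _ => sq_nonneg _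
  have h3 := mul_le_mul_of_nonneg_left e2 hb0.le
  rw [deficit]
  by_contra! h4
  have h5 := mul_lt_mul_of_pos_left h4 hb0
  linarith

lemma integral_weight_of_le {a : ℝ} (ha : 0 ≤ a) :
    ∫ s in Ioo 0 a, (1 - s) = a - a ^ 2 / 2 := by
  rw [← integral_Ioc_eq_integral_Ioo, ← intervalIntegral.integral_of_le ha,
    intervalIntegral.integral_sub (by simp) (by simp)]
  simp

/-- The weight `1 - s` has mass at least `a / 2` on `(0, a)`, and the integrand there is at least
half the weight. With `pot_le_half`, this bounds the time spent above `-π/2`. -/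
lemma div_four_le_deficit {θ : ℝ → ℝ} (hθ : Continuous θ) {a : ℝ} (ha : a ∈ Icc (0 : ℝ) 1)
    (h : ∀ s ∈ Ioo 0 a, pot (θ s) ≤ 1 / 2) : a / 4 ≤ deficit θ := by
  have hc : Continuous fun s => (1 - s) * (1 - pot (θ s)) := by
    have := continuous_pot.comp hθ
    exact (continuous_const.sub continuous_id).mul (continuous_const.sub this)
  have hi := integrableOn_of_continuousOn hc.continuousOn
  have hsub : Ioo 0 a ⊆ Ioo (0 : ℝ) 1 := Ioo_subset_Ioo_right ha.2
  have h1 : ∫ s in Ioo 0 a, (1 - s) * (1 - pot (θ s)) ≤ deficit θ :=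
    setIntegral_mono_set hi ((ae_restrict_iff' measurableSet_Ioo).2 (ae_of_all _ fun s hs =>
      mul_nonneg (by linarith [hs.2]) (by linarith [pot_le_one (θ s)]))) (ae_of_all _ hsub)
  have h2 : ∫ s in Ioo 0 a, (1 / 2) * (1 - s) ≤ ∫ s in Ioo 0 a, (1 - s) * (1 - pot (θ s)) := by
    refine setIntegral_mono_on ((integrableOn_of_continuousOn (by fun_prop)).mono_set hsub)
      (hi.mono_set hsub) measurableSet_Ioo fun s hs => ?_
    have := h s hs
    have : s < 1 := (hsub hs).2
    nlinarith
  rw [integral_const_mul, integral_weight_of_le ha.1] at h2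
  nlinarith [ha.1, ha.2]

/-- A maximal interval to the right of `a` on which a continuous function is positive. -/
lemma exists_excursion {f : ℝ → ℝ} (hf : Continuous f) {a s : ℝ} (has : a ≤ s) (hs1 : s ≤ 1)
    (ha : f a ≤ 0) (hs : 0 < f s) : ∃ σ σ', a ≤ σ ∧ σ < σ' ∧ σ' ≤ 1 ∧ f σ = 0 ∧
      (σ' = 1 ∨ f σ' = 0) ∧ ∀ t ∈ Ioo σ σ', 0 < f t := by
  have hK : IsCompact (Icc a s ∩ f ⁻¹' Iic 0) :=
    isCompact_Icc.inter_right (isClosed_Iic.preimage hf)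
  obtain ⟨⟨haσ, hσs⟩, hσ⟩ := hK.sSup_mem ⟨a, left_mem_Icc.2 has, ha⟩
  set σ := sSup (Icc a s ∩ f ⁻¹' Iic 0)
  have hσpos : ∀ t ∈ Ioc σ s, 0 < f t := fun t ht => by
    by_contra! h
    exact absurd (le_csSup hK.bddAbove ⟨⟨haσ.trans ht.1.le, ht.2⟩, h⟩) (not_le.2 ht.1)
  have hσs' : σ < s := lt_of_le_of_ne hσs fun h => by
    rw [h] at hσ
    exact absurd hs (not_lt.2 hσ)
  have hσ0 : f σ = 0 := by
    refine le_antisymm hσ (ge_of_tendsto (hf.continuousWithinAt (s := Ioi σ) (x := σ)) ?_)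
    filter_upwards [Ioc_mem_nhdsGT hσs'] with t ht using (hσpos t ht).le
  by_cases hne : (Icc s 1 ∩ f ⁻¹' Iic 0).Nonempty
  · have hK' : IsCompact (Icc s 1 ∩ f ⁻¹' Iic 0) :=
      isCompact_Icc.inter_right (isClosed_Iic.preimage hf)
    obtain ⟨⟨hsσ', hσ'1⟩, hσ'⟩ := hK'.sInf_mem hne
    set σ' := sInf (Icc s 1 ∩ f ⁻¹' Iic 0)
    have hpos : ∀ t ∈ Ico s σ', 0 < f t := fun t ht => by
      by_contra! h
      exact absurd (csInf_le hK'.bddBelow ⟨⟨ht.1, ht.2.le.trans hσ'1⟩, h⟩) (not_le.2 ht.2)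
    have hsσ'' : s < σ' := lt_of_le_of_ne hsσ' fun h => by
      rw [← h] at hσ'
      exact absurd hs (not_lt.2 hσ')
    refine ⟨σ, σ', haσ, hσs'.trans hsσ'', hσ'1, hσ0, Or.inr ?_, fun t ht => ?_⟩
    · refine le_antisymm hσ' (ge_of_tendsto (hf.continuousWithinAt (s := Iio σ') (x := σ')) ?_)
      filter_upwards [Ico_mem_nhdsLT hsσ''] with t ht using (hpos t ht).le
    · rcases le_total t s with h | h
      · exact hσpos t ⟨ht.1, h⟩
      · exact hpos t ⟨h, ht.2⟩
  · refine ⟨σ, 1, haσ, hσs'.trans_le hs1, le_rfl, hσ0, Or.inl rfl, fun t ht => ?_⟩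
    rcases le_total t s with h | h
    · exact hσpos t ⟨ht.1, h⟩
    · by_contra! h'
      exact hne ⟨t, ⟨h, ht.2.le⟩, h'⟩

/-- The first time at which `θ` takes the value `-π/2`. -/
lemma exists_first_crossing {θ : ℝ → ℝ} (hθ : Continuous θ) (h0 : θ 0 = 0)
    (hd : deficit θ ≤ 1 / 1000) : ∃ τ, 0 < τ ∧ τ ≤ 1 / 250 ∧ θ τ = -(π / 2) ∧
      ∀ s ∈ Ico 0 τ, -(π / 2) < θ s := by
  have hK : IsCompact (Icc 0 1 ∩ θ ⁻¹' Iic (-(π / 2))) :=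
    isCompact_Icc.inter_right (isClosed_Iic.preimage hθ)
  have hne : (Icc 0 1 ∩ θ ⁻¹' Iic (-(π / 2))).Nonempty := by
    by_contra hne
    -- Without a crossing the deficit would be at least `1/4`.
    have := div_four_le_deficit hθ (right_mem_Icc.2 zero_le_one) fun s hs => pot_le_half (by
      by_contra! h
      exact hne ⟨s, Ioo_subset_Icc_self hs, h.le⟩)
    linarith
  obtain ⟨⟨hτ0, hτ1⟩, hτ⟩ := hK.sInf_mem hne
  set τ := sInf (Icc 0 1 ∩ θ ⁻¹' Iic (-(π / 2)))
  have hlt : ∀ s ∈ Ico 0 τ, -(π / 2) < θ s := fun s hs => by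
    by_contra! h
    exact absurd (csInf_le hK.bddBelow ⟨⟨hs.1, hs.2.le.trans hτ1⟩, h⟩) (not_le.2 hs.2)
  have hτpos : 0 < τ := lt_of_le_of_ne hτ0 fun h => by
    rw [← h, mem_preimage, h0, mem_Iic] at hτ
    linarith [pi_pos]
  refine ⟨τ, hτpos, ?_, le_antisymm hτ ?_, hlt⟩
  · have := div_four_le_deficit hθ ⟨hτ0, hτ1⟩ fun s hs => pot_le_half (hlt s ⟨hs.1.le, hs.2⟩).le
    linarith
  · refine ge_of_tendsto (hθ.continuousWithinAt (s := Iio τ) (x := τ)) ?_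
    filter_upwards [Ico_mem_nhdsLT hτpos] with t ht using (hlt t ht).le

/-! ### Confinement between `-3π/2` and `-π/2` -/

lemma dpot_neg_pi_div_two : dpot (-(π / 2)) = 0 := by
  rw [dpot_of_le (by linarith [pi_pos]), cos_neg, cos_pi_div_two]

lemma dpot_neg_three_pi_div_two : dpot (-(3 * π / 2)) = 0 := by
  rw [dpot_of_le (by linarith [pi_pos]), show -(3 * π / 2) = π / 2 - 2 * π by ring, cos_sub_two_pi,
    cos_pi_div_two]

lemma pot_le_pot_reflect {x : ℝ} (hx : -(π / 2) ≤ x) : pot x ≤ pot (-π - x) := by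
  rw [pot_of_le (show -π - x ≤ 1 / 4 by linarith [pi_pos]),
    show sin (-π - x) = sin x by rw [← neg_add', sin_neg, add_comm, sin_add_pi, neg_neg]]
  exact pot_le_sin x

/-- An excursion above `-π/2` can be reflected about that level (`c = -1`): the sine is symmetric
there and the penalty can only disappear. The surgery lemma then makes the excursion constant, which
is absurd. -/
lemma IsExtremal.le_neg_pi_div_two {b : ℝ} (hb : 0 ≤ b) {θ p : ℝ → ℝ} (h : IsExtremal b θ p)
    (hmin : IsMinimizer b p) {τ : ℝ} (hτ0 : 0 < τ) (hτ : θ τ = -(π / 2)) :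
    ∀ s ∈ Icc τ 1, θ s ≤ -(π / 2) := by
  intro s hs
  by_contra! hlt
  obtain ⟨σ, σ', h1, h2, h3, h4, h5, h6⟩ := exists_excursion (f := fun s => θ s + π / 2)
    (h.continuous.add continuous_const) hs.1 hs.2 (by rw [hτ]; linarith) (by linarith)
  have hσ : θ σ = -(π / 2) := by linarith
  have := h.eq_of_surgery hb hmin (c := -1) (hτ0.trans_le h1) h2 h3 (by norm_num) (by norm_num)
    (h5.imp_right fun h5 => by linarith) (fun t ht => by
      have := pot_le_pot_reflect (show -(π / 2) ≤ θ t by linarith [h6 t ht])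
      rwa [hσ, show -(π / 2) + -1 * (θ t - -(π / 2)) = -π - θ t by ring])
    ((σ + σ') / 2) ⟨by linarith, by linarith⟩
  have h7 := h6 ((σ + σ') / 2) ⟨by linarith, by linarith⟩
  rw [this, hσ] at h7
  linarith

/-- An excursion below `-3π/2` can be flattened (`c = 0`), since `pot` is maximal at that level. -/
lemma IsExtremal.neg_three_pi_div_two_le {b : ℝ} (hb : 0 ≤ b) {θ p : ℝ → ℝ}
    (h : IsExtremal b θ p) (hmin : IsMinimizer b p) :
    ∀ s ∈ Icc (0 : ℝ) 1, -(3 * π / 2) ≤ θ s := by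
  intro s hs
  by_contra! hlt
  obtain ⟨σ, σ', h1, h2, h3, h4, h5, h6⟩ := exists_excursion (f := fun s => -(3 * π / 2) - θ s)
    (continuous_const.sub h.continuous) hs.1 hs.2 (by rw [h.clamped]; linarith [pi_pos])
    (by linarith)
  have hσ : θ σ = -(3 * π / 2) := by linarith
  have hσ0 : 0 < σ := lt_of_le_of_ne h1 fun h7 => by
    rw [← h7, h.clamped] at hσ
    linarith [pi_pos]
  have := h.eq_of_surgery hb hmin (c := 0) hσ0 h2 h3 (by norm_num) (by norm_num)
    (h5.imp_right fun h5 => by linarith) (fun t ht => by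
      rw [hσ, zero_mul, add_zero, pot_neg_three_pi_div_two]
      exact pot_le_one _)
    ((σ + σ') / 2) ⟨by linarith, by linarith⟩
  have h7 := h6 ((σ + σ') / 2) ⟨by linarith, by linarith⟩
  rw [this, hσ] at h7
  linarith

/-- Touching the level would happen with zero slope, by maximality in the interior or by the free
condition at `1`, and `-π/2` is an equilibrium, so `IsExtremal.deriv_ne_zero` applies. -/
lemma IsExtremal.lt_neg_pi_div_two {b : ℝ} (hb : 0 ≤ b) {θ p : ℝ → ℝ} (h : IsExtremal b θ p)
    (hmin : IsMinimizer b p) {τ : ℝ} (hτ0 : 0 < τ) (hτ : θ τ = -(π / 2)) :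
    ∀ s ∈ Ioc τ 1, θ s < -(π / 2) := by
  intro s hs
  have hle := h.le_neg_pi_div_two hb hmin hτ0 hτ
  refine lt_of_le_of_ne (hle s (Ioc_subset_Icc_self hs)) fun heq => ?_
  refine h.deriv_ne_zero hb ⟨(hτ0.trans hs.1).le, hs.2⟩ (by rw [heq, dpot_neg_pi_div_two])
    (by rw [heq]; linarith [pi_pos]) ?_
  rcases hs.2.lt_or_eq with h1 | h1
  · refine IsLocalMax.hasDerivAt_eq_zero (f := θ) (a := s) ?_ (h.hasDerivAt s)
    filter_upwards [Ioo_mem_nhds hs.1 h1] with t ht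
    rw [heq]
    exact hle t (Ioo_subset_Icc_self ht)
  · rw [h1, h.free]

lemma IsExtremal.neg_three_pi_div_two_lt {b : ℝ} (hb : 0 ≤ b) {θ p : ℝ → ℝ}
    (h : IsExtremal b θ p) (hmin : IsMinimizer b p) :
    ∀ s ∈ Ioc (0 : ℝ) 1, -(3 * π / 2) < θ s := by
  intro s hs
  have hle := h.neg_three_pi_div_two_le hb hmin
  refine lt_of_le_of_ne (hle s (Ioc_subset_Icc_self hs)) fun heq => ?_
  refine h.deriv_ne_zero hb (Ioc_subset_Icc_self hs) (by rw [← heq, dpot_neg_three_pi_div_two])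
    (by rw [← heq]; linarith [pi_pos]) ?_
  rcases hs.2.lt_or_eq with h1 | h1
  · refine IsLocalMin.hasDerivAt_eq_zero (f := θ) (a := s) ?_ (h.hasDerivAt s)
    filter_upwards [Ioo_mem_nhds hs.1 h1] with t ht
    rw [← heq]
    exact hle t (Ioo_subset_Icc_self ht)
  · rw [h1, h.free]

/-! ### The shift argument: no early return to zero -/

/-- The change of the potential energy under a shift of the argument. -/
lemma integral_shift_sub {f : ℝ → ℝ} (hf : Continuous f) (a : ℝ) :
    (∫ s in (0 : ℝ)..1, (1 - s) * f (s + a)) - ∫ s in (0 : ℝ)..1, (1 - s) * f s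
      = a * (∫ s in a..1, f s) + (∫ s in (1 : ℝ)..(1 + a), (1 + a - s) * f s)
        - ∫ s in (0 : ℝ)..a, (1 - s) * f s := by
  have i1 : ∀ x y : ℝ, IntervalIntegrable (fun s => (1 - s) * f s) volume x y := fun x y =>
    Continuous.intervalIntegrable (by fun_prop) _ _
  have i2 : ∀ x y : ℝ, IntervalIntegrable (fun s => (1 + a - s) * f s) volume x y := fun x y =>
    Continuous.intervalIntegrable (by fun_prop) _ _
  have e1 : ∫ s in (0 : ℝ)..1, (1 - s) * f (s + a) = ∫ s in a..(1 + a), (1 + a - s) * f s := by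
    have := intervalIntegral.integral_comp_add_right (a := 0) (b := 1)
      (fun s => (1 + a - s) * f s) a
    rw [zero_add] at this
    rw [← this]
    refine intervalIntegral.integral_congr fun s _ => ?_
    ring
  have e2 : ∫ s in a..1, (1 + a - s) * f s
      = (∫ s in a..1, (1 - s) * f s) + a * ∫ s in a..1, f s := by
    rw [← intervalIntegral.integral_const_mul, ← intervalIntegral.integral_add (i1 _ _)
      ((hf.intervalIntegrable _ _).const_mul _)]
    refine intervalIntegral.integral_congr fun s _ => ?_
    ring
  rw [e1, ← intervalIntegral.integral_add_adjacent_intervals (i2 a 1) (i2 1 (1 + a)), e2,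
    ← intervalIntegral.integral_add_adjacent_intervals (i1 0 a) (i1 a 1)]
  ring

/-- A minimiser does not return to `0` before it reaches `-π/2`: otherwise shifting its argument
would decrease the functional. -/
lemma IsExtremal.ne_zero {b : ℝ} (hb : 0 < b) {θ p : ℝ → ℝ} (h : IsExtremal b θ p)
    (hmin : IsMinimizer b p) (hd : deficit θ ≤ 1 / 1000) {τ : ℝ} (hτ1 : τ ≤ 1 / 250)
    (hlt : ∀ s ∈ Ico 0 τ, -(π / 2) < θ s) (hge : ∀ s ∈ Icc τ 1, -1 ≤ pot (θ s)) :
    ∀ a ∈ Ioo 0 τ, θ a ≠ 0 := by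
  intro a ha ha0
  have ha1 : a < 1 / 250 := ha.2.trans_le hτ1
  have ha00 := ha.1
  let k : ℝ → ℝ := fun s => p (s + a)
  have hk : Continuous k := h.continuous_deriv.comp (continuous_add_const a)
  set g : ℝ → ℝ := (Ioc 0 (1 - a)).indicator k with hg
  have hg2 : L2 g := L2.indicator (L2.of_continuousOn hk.continuousOn) measurableSet_Ioc
  let f : ℝ → ℝ := fun s => pot (θ (min s 1))
  have hf : Continuous f := continuous_pot.comp (h.continuous.comp (by fun_prop))
  have hprim : ∀ s ∈ Ioo (0 : ℝ) 1, pot (primitive g s) = f (s + a) := fun s hs => by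
    rw [hg, primitive_indicator (Φ := fun x => θ (x + a)) (f := k)
      (fun x => (h.hasDerivAt (x + a)).comp_add_const x a) hk le_rfl (by linarith) hs.1.le,
      zero_add, ha0, sub_zero, max_eq_right (le_min hs.1.le (by linarith)), ← min_add_add_right,
      sub_add_cancel]
  have e1 : ∫ s in Ioo (0 : ℝ) 1, g s ^ 2 ≤ ∫ s in Ioo (0 : ℝ) 1, p s ^ 2 := by
    have hc : Continuous fun s => p s ^ 2 := h.continuous_deriv.pow 2
    have h1 : ∀ s, g s ^ 2 = (Ioc 0 (1 - a)).indicator (fun s => p (s + a) ^ 2) s := fun s => by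
      by_cases hs : s ∈ Ioc 0 (1 - a) <;> simp [hg, hs, k]
    simp_rw [h1]
    rw [setIntegral_indicator_Ioc (by linarith), ← intervalIntegral.integral_of_le (by linarith),
      intervalIntegral.integral_comp_add_right (fun s => p s ^ 2), zero_add, sub_add_cancel,
      setIntegral_Ioo_eq, ← intervalIntegral.integral_add_adjacent_intervals
        (hc.intervalIntegrable 0 a) (hc.intervalIntegrable a 1)]
    have := intervalIntegral.integral_nonneg (μ := volume) ha00.le
      fun s _ => sq_nonneg (p s)
    linarith
  have e2 : ∫ s in Ioo (0 : ℝ) 1, (1 - s) * pot (primitive g s)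
      = ∫ s in (0 : ℝ)..1, (1 - s) * f (s + a) := by
    rw [← setIntegral_Ioo_eq]
    exact setIntegral_congr_fun measurableSet_Ioo fun s hs => by simp only [hprim s hs]
  have hfeq : ∀ s ≤ (1 : ℝ), f s = pot (θ s) := fun s hs => by simp only [f, min_eq_left hs]
  have e3 : ∫ s in Ioo (0 : ℝ) 1, (1 - s) * pot (primitive p s)
      = ∫ s in (0 : ℝ)..1, (1 - s) * f s := by
    rw [← setIntegral_Ioo_eq, h.primitive_eq]
    exact setIntegral_congr_fun measurableSet_Ioo fun s hs => by simp only [hfeq s hs.2.le]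
  have hact := hmin.2 g hg2
  have hle : ∫ s in (0 : ℝ)..1, (1 - s) * f (s + a) ≤ ∫ s in (0 : ℝ)..1, (1 - s) * f s := by
    rw [action, action, e2, e3] at hact
    by_contra! h1
    have := mul_lt_mul_of_pos_left h1 hb
    linarith
  have hshift := integral_shift_sub hf a
  have b1 : ∫ s in (0 : ℝ)..a, (1 - s) * f s ≤ a / 2 := by
    have : ∫ s in (0 : ℝ)..a, (1 - s) * f s ≤ ∫ s in (0 : ℝ)..a, (1 / 2 : ℝ) := by
      refine intervalIntegral.integral_mono_on ha00.le
        (Continuous.intervalIntegrable (by fun_prop) _ _) (by simp) fun s hs => ?_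
      have h1 : f s ≤ 1 / 2 := by
        rw [hfeq s (by linarith [hs.2])]
        exact pot_le_half (hlt s ⟨hs.1, hs.2.trans_lt ha.2⟩).le
      nlinarith [hs.1, hs.2]
    simp at this
    linarith
  have b2 : -(a * a) ≤ ∫ s in (1 : ℝ)..(1 + a), (1 + a - s) * f s := by
    have : ∫ s in (1 : ℝ)..(1 + a), -a ≤ ∫ s in (1 : ℝ)..(1 + a), (1 + a - s) * f s := by
      refine intervalIntegral.integral_mono_on (by linarith) (by simp)
        (Continuous.intervalIntegrable (by fun_prop) _ _) fun s hs => ?_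
      have h1 : -1 ≤ f s := by
        simp only [f, min_eq_right hs.1]
        exact hge 1 ⟨by linarith, le_rfl⟩
      nlinarith [hs.1, hs.2]
    simp at this
    linarith
  have hc1 : Continuous fun s => (1 - s) * (1 - f s) := by fun_prop
  have hdef : ∫ s in (0 : ℝ)..1, (1 - s) * (1 - f s) ≤ 1 / 1000 := by
    refine le_trans (le_of_eq ?_) hd
    rw [← setIntegral_Ioo_eq, deficit]
    exact setIntegral_congr_fun measurableSet_Ioo fun s hs => by simp only [hfeq s hs.2.le]
  have hf1 : ∀ s, f s ≤ 1 := fun s => pot_le_one _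
  -- Up to `9/10` the weight is at least `1/10`, so the deficit controls `∫ (1 - f)` by `1/100`. On
  -- the last tenth the crude bound `1 - f ≤ 2` costs `1/5`.
  have b3 : 7 / 10 ≤ ∫ s in a..1, f s := by
    have h1 : ∫ s in a..(9 / 10), (1 - f s) ≤ 10 * (1 / 1000) := by
      calc ∫ s in a..(9 / 10), (1 - f s) ≤ ∫ s in a..(9 / 10), 10 * ((1 - s) * (1 - f s)) := by
            refine intervalIntegral.integral_mono_on (by linarith)
              (Continuous.intervalIntegrable (by fun_prop) _ _)
              (Continuous.intervalIntegrable (by fun_prop) _ _) fun s hs => ?_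
            nlinarith [hf1 s, hs.2]
        _ = 10 * ∫ s in a..(9 / 10), (1 - s) * (1 - f s) := intervalIntegral.integral_const_mul _ _
        _ ≤ 10 * ∫ s in (0 : ℝ)..1, (1 - s) * (1 - f s) := by
            refine mul_le_mul_of_nonneg_left ?_ (by norm_num)
            refine intervalIntegral.integral_mono_interval ha00.le (by linarith) (by norm_num) ?_
              (hc1.intervalIntegrable _ _)
            rw [EventuallyLE, ae_restrict_iff' measurableSet_Ioc]
            exact ae_of_all _ fun s hs =>
              mul_nonneg (by linarith [hs.2]) (by linarith [hf1 s])
        _ ≤ 10 * (1 / 1000) := by linarith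
    have h2 : ∫ s in (9 / 10 : ℝ)..1, (1 - f s) ≤ ∫ s in (9 / 10 : ℝ)..1, (2 : ℝ) := by
      refine intervalIntegral.integral_mono_on (by norm_num)
        (Continuous.intervalIntegrable (by fun_prop) _ _) (by simp) fun s hs => ?_
      have := hge s ⟨by linarith [hs.1], hs.2⟩
      rw [← hfeq s hs.2] at this
      linarith
    have h3 := intervalIntegral.integral_add_adjacent_intervals (μ := volume)
      (Continuous.intervalIntegrable (by fun_prop : Continuous fun s => 1 - f s) a (9 / 10))
      (Continuous.intervalIntegrable (by fun_prop : Continuous fun s => 1 - f s) (9 / 10) 1)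
    rw [intervalIntegral.integral_sub (a := a) (b := 1) (by simp) (hf.intervalIntegrable _ _)] at h3
    simp only [intervalIntegral.integral_const, smul_eq_mul, mul_one] at h2 h3
    linarith
  have b4 := mul_le_mul_of_nonneg_left b3 ha00.le
  -- The shift would raise the potential term by at least `7a/10 - a² - a/2`, which is positive for
  -- `0 < a < 1/250`.
  nlinarith

/-! ### Monotonicity of minimisers -/

/-- Qualitative behaviour of the minimisers of the penalised functional for large `b`. -/
theorem IsExtremal.strictAntiOn {b : ℝ} (hb : 10 ^ 8 ≤ b) {θ p : ℝ → ℝ} (h : IsExtremal b θ p)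
    (hmin : IsMinimizer b p) : StrictAntiOn θ (Icc 0 1) := by
  have hb0 : 0 < b := by linarith
  have hd : deficit θ ≤ 1 / 1000 := by
    have := deficit_le hb hmin
    rwa [h.primitive_eq] at this
  have hθc := h.continuous
  have hpc := h.continuous_deriv
  obtain ⟨τ, hτ0, hτ1, hτ, hlt⟩ := exists_first_crossing hθc h.clamped hd
  have hle := h.le_neg_pi_div_two hb0.le hmin hτ0 hτ
  have hlt' := h.lt_neg_pi_div_two hb0.le hmin hτ0 hτ
  have hgt := h.neg_three_pi_div_two_lt hb0.le hmin
  have hne := h.ne_zero hb0 hmin hd hτ1 hlt fun s hs => by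
    rw [pot_of_le (by linarith [hle s hs, pi_pos])]
    exact neg_one_le_sin _
  have hneg : ∀ s ∈ Ioo 0 τ, θ s < 0 := fun s hs => by
    by_contra! h1
    obtain ⟨a, ha, ha0⟩ := intermediate_value_Icc' hs.2.le hθc.continuousOn
      (show (0 : ℝ) ∈ Icc (θ τ) (θ s) from ⟨by rw [hτ]; linarith [pi_pos], h1⟩)
    refine hne a ⟨hs.1.trans_le ha.1, lt_of_le_of_ne ha.2 fun h2 => ?_⟩ ha0
    rw [h2, hτ] at ha0
    linarith [pi_pos]
  have hanti : StrictAntiOn p (Icc 0 τ) := by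
    refine strictAntiOn_of_deriv_neg (convex_Icc _ _) hpc.continuousOn fun s hs => ?_
    rw [interior_Icc] at hs
    rw [(h.hasDerivAt_deriv s ⟨hs.1.le, by linarith [hs.2]⟩).deriv,
      dpot_of_le (by linarith [hneg s hs])]
    have h1 : 0 < cos (θ s) := cos_pos_of_mem_Ioo
      ⟨hlt s ⟨hs.1.le, hs.2⟩, by linarith [hneg s hs, pi_pos]⟩
    have h2 : 0 < b * (1 - s) := mul_pos hb0 (by linarith [hs.2])
    nlinarith [mul_pos h2 h1]
  have hmono : StrictMonoOn p (Icc τ 1) := by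
    refine strictMonoOn_of_deriv_pos (convex_Icc _ _) hpc.continuousOn fun s hs => ?_
    rw [interior_Icc] at hs
    have hs1 : s ∈ Ioc τ 1 := ⟨hs.1, hs.2.le⟩
    have h3 := hlt' s hs1
    have h4 := hgt s ⟨hτ0.trans hs.1, hs.2.le⟩
    rw [(h.hasDerivAt_deriv s ⟨(hτ0.trans hs.1).le, hs.2.le⟩).deriv,
      dpot_of_le (by linarith [pi_pos])]
    have h1 : cos (θ s) < 0 := by
      rw [← cos_neg]
      exact cos_neg_of_pi_div_two_lt_of_lt (by linarith) (by linarith)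
    have h2 : 0 < b * (1 - s) := mul_pos hb0 (by linarith [hs.2])
    nlinarith [mul_pos_of_neg_of_neg (neg_neg_of_pos h2) h1]
  -- A nonnegative slope at `s` would, by concavity, make `θ` increase from `0` on `[0, s]`, against
  -- `θ s < 0`.
  have hp1 : ∀ s ∈ Ioo 0 τ, p s < 0 := fun s hs => by
    by_contra! h1
    have h2 : StrictMonoOn θ (Icc 0 s) := by
      refine strictMonoOn_of_deriv_pos (convex_Icc _ _) hθc.continuousOn fun t ht => ?_
      rw [interior_Icc] at ht
      rw [(h.hasDerivAt t).deriv]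
      exact h1.trans_lt (hanti ⟨ht.1.le, (ht.2.trans hs.2).le⟩ ⟨hs.1.le, hs.2.le⟩ ht.2)
    have h3 := h2 (left_mem_Icc.2 hs.1.le) (right_mem_Icc.2 hs.1.le) hs.1
    rw [h.clamped] at h3
    linarith [hneg s hs]
  have hp2 : ∀ s ∈ Ico τ 1, p s < 0 := fun s hs => by
    rw [← h.free]
    exact hmono (Ico_subset_Icc_self hs) (right_mem_Icc.2 (by linarith)) hs.2
  refine strictAntiOn_of_deriv_neg (convex_Icc _ _) hθc.continuousOn fun s hs => ?_
  rw [interior_Icc] at hs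
  rw [(h.hasDerivAt s).deriv]
  rcases lt_or_ge s τ with h1 | h1
  · exact hp1 s ⟨hs.1, h1⟩
  · exact hp2 s ⟨h1, hs.2⟩

/-! ### Return to the original energy -/

/-- Comparison with competitors on which the penalisation is not active. -/
lemma energy_le_of_isMinimizer {b : ℝ} {θ p u : ℝ → ℝ} (h : IsExtremal b θ p)
    (hmin : IsMinimizer b p) (hneg : ∀ s ∈ Ioo (0 : ℝ) 1, θ s ≤ 1 / 4) (hu : u ∈ H101)
    (hu4 : ∀ s ∈ Ioo (0 : ℝ) 1, u s ≤ 1 / 4) : energy b θ ≤ energy b u := by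
  rw [energy_eq_action (F := pot) h.memL2 (fun s _ => by rw [h.primitive_eq])
      fun s hs => pot_of_le (hneg s hs),
    energy_eq_action (F := pot) (L2_weakDeriv hu) (eqOn_primitive_weakDeriv hu)
      fun s hs => pot_of_le (hu4 s hs)]
  exact hmin.2 _ (L2_weakDeriv hu)

lemma IsExtremal.isClassicalSolution {b : ℝ} {θ p : ℝ → ℝ} (h : IsExtremal b θ p)
    (hneg : ∀ s ∈ Icc (0 : ℝ) 1, θ s ≤ 1 / 4) : IsClassicalSolution b θ := by
  have hu : UniqueDiffOn ℝ (Icc (0 : ℝ) 1) := uniqueDiffOn_Icc zero_lt_one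
  have hd : EqOn (derivWithin θ (Icc 0 1)) p (Icc 0 1) := fun s hs =>
    (h.hasDerivAt s).hasDerivWithinAt.derivWithin (hu s hs)
  refine ⟨h.contDiff.contDiffOn, fun s hs => ?_, h.clamped, ?_⟩
  · rw [derivWithin_congr hd (hd hs),
      (h.hasDerivAt_deriv s hs).hasDerivWithinAt.derivWithin (hu s hs), dpot_of_le (hneg s hs)]
  · rw [hd (right_mem_Icc.2 zero_le_one), h.free]

end Elastica

end

theorem mainTheorem1 :
    ∃ b₀ : ℝ, 0 < b₀ ∧ ∀ b : ℝ, b₀ < b → ∃ θ : ℝ → ℝ,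
      Elastica.IsLocalMinimizer b θ ∧
      Elastica.IsClassicalSolution b θ ∧
      (∀ s ∈ Set.Ioc (0 : ℝ) 1, θ s < 0) ∧
      StrictAntiOn θ (Set.Ioc (0 : ℝ) 1) ∧
      IsMinOn (Elastica.energy b) Elastica.negCone θ := by
  refine ⟨10 ^ 8, by norm_num, fun b hb => ?_⟩
  have hb0 : 0 ≤ b := by linarith
  obtain ⟨g, hg⟩ := Elastica.exists_minimizer hb0 Elastica.continuous_pot Elastica.pot_le_one
  obtain ⟨θ, p, h, hgp, -⟩ := Elastica.IsMinimizer.exists_isExtremal hb0 hg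
  have hmin : Elastica.IsMinimizer b p := Elastica.IsMinimizer.congr_ae hg hgp
  have hanti := h.strictAntiOn hb.le hmin
  have hneg : ∀ s ∈ Set.Ioc (0 : ℝ) 1, θ s < 0 := fun s hs => by
    rw [← h.clamped]
    exact hanti (Set.left_mem_Icc.2 zero_le_one) (Set.Ioc_subset_Icc_self hs) hs.1
  have hle : ∀ s ∈ Set.Icc (0 : ℝ) 1, θ s ≤ 0 := fun s hs => by
    rw [← h.clamped]
    exact hanti.antitoneOn (Set.left_mem_Icc.2 zero_le_one) hs hs.1
  have hmem : θ ∈ Elastica.H101 :=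
    Elastica.mem_H101_of_eqOn_primitive h.memL2 fun s _ => by rw [h.primitive_eq]
  have hθ4 : ∀ s ∈ Set.Icc (0 : ℝ) 1, θ s ≤ 1 / 4 := fun s hs => by linarith [hle s hs]
  -- The radius `1/4` matches the onset of the penalty: as `θ ≤ 0`, the Sobolev inequality keeps
  -- every `u` in this ball below `1/4`.
  refine ⟨θ, ⟨hmem, 1 / 4, by norm_num, fun u hu hclose => ?_⟩, h.isClassicalSolution hθ4, hneg,
    hanti.mono Set.Ioc_subset_Icc_self, fun u hu => ?_⟩
  · refine Elastica.energy_le_of_isMinimizer h hmin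
      (fun s hs => hθ4 s (Set.Ioo_subset_Icc_self hs)) hu fun s hs => ?_
    have hs' := Set.Ioo_subset_Icc_self hs
    have h1 := (le_abs_self _).trans
      (Elastica.abs_le_h1Norm (Elastica.sub_mem_H101 hu hmem) hs')
    linarith [hle s hs']
  · exact Elastica.energy_le_of_isMinimizer h hmin
      (fun s hs => hθ4 s (Set.Ioo_subset_Icc_self hs)) hu.1
      fun s hs => by linarith [hu.2 s (Set.Ioo_subset_Ioc_self hs)]
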